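/- Let $k$ be a field and let $D_Z \xrightarrow{\,i_*\,} D_X \xrightarrow{\,j^*\,} D_U$ be a recollement of $k$-linear Hom-finite triangulated categories (all spaces of morphisms are finite-dimensional over $k$). That is, $i_*$ and $j^*$ are $k$-linear triangulated functors; $i_*$ has a left adjoint $i^*$ and a right adjoint $i^!$, and $j^*$ has a left adjoint $j_!$ and a right adjoint $j_*$; $j^*i_*=0$; the functors $i_*$, $j_!$ and $j_*$ are fully faithful; and for each object $K$ of $D_X$ the adjunction morphisms fit into distinguished triangles $$j_!j^*K \to K \to i_*i^*K \to (j_!j^*K)[1], \qquad i_*i^!K \to K \to j_*j^*K \to (i_*i^!K)[1].$$ Suppose given bounded t-structures on $D_Z$ and $D_U$ whose hearts are length categories (every object is noetherian and artinian) with finitely many simple objects up to isomorphism. Let $D_X$ carry the glued t-structure $$D_X^{\le n}=\{K : j^*K\in D_U^{\le n},\ i^*K\in D_Z^{\le n}\},\qquad D_X^{\ge n}=\{K : j^*K\in D_U^{\ge n},\ i^!K\in D_Z^{\ge n}\}.$$ Then the heart of the glued t-structure on $D_X$ has enough projectives if and only if the hearts of the t-structures on $D_Z$ and on $D_U$ both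 have enough projectives. -/

import Mathlib

open CategoryTheory CategoryTheory.Limits CategoryTheory.Pretriangulated
  CategoryTheory.Triangulated

universe w v₁ v₂ v₃ u₁ u₂ u₃

namespace RecollementGluing

/-- A category is a *length category* if every object is both noetherian and artinian.
In an abelian category, this says that every object has a finite composition series with
simple quotients. -/
def IsLengthCategory (A : Type u₁) [Category.{v₁} A] : Prop :=
  ∀ X : A, IsNoetherianObject X ∧ IsArtinianObject X

/-- There are only finitely many isomorphism classes of simple objects. -/
def HasFinitelyManySimples (A : Type u₁) [Category.{v₁} A] [HasZeroMorphisms A] : Prop :=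
  ∃ (n : ℕ) (S : Fin n → A), ∀ X : A, Simple X → ∃ i, Nonempty (X ≅ S i)

/-- A `k`-linear category is *Hom-finite* if all the spaces of morphisms are
finite-dimensional. -/
def IsHomFinite (k : Type w) [Field k] (C : Type u₁) [Category.{v₁} C] [Preadditive C]
    [Linear k C] : Prop :=
  ∀ X Y : C, Module.Finite k (X ⟶ Y)

section Bounded

variable {C : Type u₁} [Category.{v₁} C] [Preadditive C] [HasZeroObject C] [HasShift C ℤ]
  [∀ n : ℤ, (shiftFunctor C n).Additive] [Pretriangulated C]

/-- A t-structure is *bounded* if every object `X` lies in `D^{≥ a} ∩ D^{≤ b}` for some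
integers `a` and `b`. -/
def IsBoundedTStructure (t : TStructure C) : Prop := ∀ X : C, t.bounded X

end Bounded

variable (k : Type w) [Field k]
  (DZ : Type u₁) [Category.{v₁} DZ] [Preadditive DZ] [HasZeroObject DZ] [HasShift DZ ℤ]
  [∀ n : ℤ, (shiftFunctor DZ n).Additive] [Pretriangulated DZ] [Linear k DZ]
  (DX : Type u₂) [Category.{v₂} DX] [Preadditive DX] [HasZeroObject DX] [HasShift DX ℤ]
  [∀ n : ℤ, (shiftFunctor DX n).Additive] [Pretriangulated DX] [Linear k DX]
  (DU : Type u₃) [Category.{v₃} DU] [Preadditive DU] [HasZeroObject DU] [HasShift DU ℤ]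
  [∀ n : ℤ, (shiftFunctor DU n).Additive] [Pretriangulated DU] [Linear k DU]

/-- A recollement `DZ ⟶ DX ⟶ DU` of `k`-linear triangulated categories, following Beilinson,
Bernstein and Deligne. The functors `i_*` and `j^*` are `k`-linear triangulated functors;
their adjoints are then automatically triangulated. -/
structure Recollement where
  /-- the functor `i_*` -/
  iStar : DZ ⥤ DX
  /-- the functor `j^*` -/
  jPull : DX ⥤ DU
  [iStar_commShift : iStar.CommShift ℤ]
  [iStar_triangulated : iStar.IsTriangulated]
  [iStar_linear : iStar.Linear k]
  [jPull_commShift : jPull.CommShift ℤ]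
  [jPull_triangulated : jPull.IsTriangulated]
  [jPull_linear : jPull.Linear k]
  /-- the functor `i^*`, left adjoint to `i_*` -/
  iPull : DX ⥤ DZ
  /-- the functor `i^!`, right adjoint to `i_*` -/
  iShriek : DX ⥤ DZ
  /-- the functor `j_!`, left adjoint to `j^*` -/
  jShriek : DU ⥤ DX
  /-- the functor `j_*`, right adjoint to `j^*` -/
  jStar : DU ⥤ DX
  /-- the adjunction between `i^*` and `i_*` -/
  iPullAdj : iPull ⊣ iStar
  /-- the adjunction between `i_*` and `i^!` -/
  iShriekAdj : iStar ⊣ iShriek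
  /-- the adjunction between `j_!` and `j^*` -/
  jShriekAdj : jShriek ⊣ jPull
  /-- the adjunction between `j^*` and `j_*` -/
  jStarAdj : jPull ⊣ jStar
  /-- the composition `j^* i_*` is zero -/
  isZero_jPull_iStar (W : DZ) : IsZero (jPull.obj (iStar.obj W))
  /-- the triangle `j_! j^* K ⟶ K ⟶ i_* i^* K ⟶` -/
  exists_triangle_shriek (K : DX) :
    ∃ d : iStar.obj (iPull.obj K) ⟶ (jShriek.obj (jPull.obj K))⟦(1 : ℤ)⟧,
      Triangle.mk (jShriekAdj.counit.app K) (iPullAdj.unit.app K) d ∈ distTriang DX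
  /-- the triangle `i_* i^! K ⟶ K ⟶ j_* j^* K ⟶` -/
  exists_triangle_star (K : DX) :
    ∃ d : jStar.obj (jPull.obj K) ⟶ (iStar.obj (iShriek.obj K))⟦(1 : ℤ)⟧,
      Triangle.mk (iShriekAdj.counit.app K) (jStarAdj.unit.app K) d ∈ distTriang DX
  [iStar_full : iStar.Full]
  [iStar_faithful : iStar.Faithful]
  [jShriek_full : jShriek.Full]
  [jShriek_faithful : jShriek.Faithful]
  [jStar_full : jStar.Full]
  [jStar_faithful : jStar.Faithful]

section Auxiliary

variable {C : Type u₁} [Category.{v₁} C] [Preadditive C] [HasZeroObject C] [HasShift C ℤ]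
  [∀ n : ℤ, (shiftFunctor C n).Additive] [Pretriangulated C]
  {D : Type u₂} [Category.{v₂} D] [Preadditive D] [HasZeroObject D] [HasShift D ℤ]
  [∀ n : ℤ, (shiftFunctor D n).Additive] [Pretriangulated D]

lemma nonempty_iso₁ {T T' : Triangle C} (hT : T ∈ distTriang C) (hT' : T' ∈ distTriang C)
    (e₂ : T.obj₂ ≅ T'.obj₂) (e₃ : T.obj₃ ≅ T'.obj₃)
    (comm : T.mor₂ ≫ e₃.hom = e₂.hom ≫ T'.mor₂) : Nonempty (T.obj₁ ≅ T'.obj₁) := by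
  obtain ⟨a, ha₁, ha₃⟩ :=
    complete_distinguished_triangle_morphism₁ T T' hT hT' e₂.hom e₃.hom comm
  let φ : T ⟶ T' := { hom₁ := a, hom₂ := e₂.hom, hom₃ := e₃.hom, comm₁ := ha₁, comm₂ := comm,
                      comm₃ := ha₃ }
  have : IsIso φ.hom₁ := isIso₁_of_isIso₂₃ φ hT hT' (inferInstanceAs (IsIso e₂.hom))
    (inferInstanceAs (IsIso e₃.hom))
  exact ⟨asIso φ.hom₁⟩

/-- If `F ⊣ G` with `F` triangulated and `G` fully faithful, and `A` is the fibre of the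
morphism `X ⟶ G Q` corresponding to `g : F X ⟶ Q`, then `F A` is the fibre of `g`. -/
lemma nonempty_iso_of_adj {F : C ⥤ D} {G : D ⥤ C} (adj : F ⊣ G) [F.CommShift ℤ]
    [F.IsTriangulated] [G.Full] [G.Faithful] {X A : C} {P Q : D} {f : P ⟶ F.obj X}
    {g : F.obj X ⟶ Q} {h : Q ⟶ P⟦(1 : ℤ)⟧} (hT : Triangle.mk f g h ∈ distTriang D)
    {a : A ⟶ X} {c : G.obj Q ⟶ A⟦(1 : ℤ)⟧}
    (hT' : Triangle.mk a (adj.homEquiv _ _ g) c ∈ distTriang C) :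
    Nonempty (F.obj A ≅ P) := by
  have i : IsIso (adj.counit.app Q) := inferInstance
  let e : F.obj (G.obj Q) ≅ Q := @asIso _ _ _ _ (adj.counit.app Q) i
  have comm : F.map (adj.homEquiv _ _ g) ≫ e.hom = 𝟙 _ ≫ g := by
    simp [e, Adjunction.homEquiv_unit]
  exact nonempty_iso₁ (F.map_distinguished _ hT') hT (Iso.refl _) e comm

end Auxiliary

namespace Recollement

attribute [instance] iStar_commShift iStar_triangulated iStar_linear jPull_commShift
  jPull_triangulated jPull_linear iStar_full iStar_faithful jShriek_full jShriek_faithful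
  jStar_full jStar_faithful

variable {k DZ DX DU}
variable (R : Recollement k DZ DX DU)

noncomputable instance : R.iPull.CommShift ℤ := R.iPullAdj.leftAdjointCommShift ℤ

noncomputable instance : R.iShriek.CommShift ℤ := R.iShriekAdj.rightAdjointCommShift ℤ

instance : R.iPull.IsTriangulated := by
  have : R.iPullAdj.CommShift ℤ := R.iPullAdj.commShift_of_rightAdjoint ℤ
  exact R.iPullAdj.isTriangulated_leftAdjoint

instance : R.iShriek.IsTriangulated := by
  have : R.iShriekAdj.CommShift ℤ := R.iShriekAdj.commShift_of_leftAdjoint ℤ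
  exact R.iShriekAdj.isTriangulated_rightAdjoint

lemma isZero_iShriek_jStar (V : DU) : IsZero (R.iShriek.obj (R.jStar.obj V)) := by
  rw [IsZero.iff_id_eq_zero]
  apply (R.iShriekAdj.homEquiv _ _).symm.injective
  apply (R.jStarAdj.homEquiv _ _).symm.injective
  exact (R.isZero_jPull_iStar _).eq_of_src _ _

lemma hom_eq_zero (tZ : TStructure DZ) (tU : TStructure DU) {X Y : DX} (f : X ⟶ Y)
    (hXU : tU.le 0 (R.jPull.obj X)) (hXZ : tZ.le 0 (R.iPull.obj X))
    (hYU : tU.ge 1 (R.jPull.obj Y)) (hYZ : tZ.ge 1 (R.iShriek.obj Y)) : f = 0 := by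
  obtain ⟨d, hd⟩ := R.exists_triangle_shriek X
  have h₁ : R.jShriekAdj.counit.app X ≫ f = 0 := by
    apply (R.jShriekAdj.homEquiv _ _).injective
    rw [tU.zero' (R.jShriekAdj.homEquiv _ _ (R.jShriekAdj.counit.app X ≫ f)) hXU hYU]
    exact (tU.zero' _ hXU hYU).symm
  obtain ⟨g, hg⟩ := Triangle.yoneda_exact₂ _ hd f h₁
  have h₂ : g = 0 := by
    apply (R.iShriekAdj.homEquiv _ _).injective
    exact (tZ.zero' _ hXZ hYZ).trans (tZ.zero' _ hXZ hYZ).symm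
  rw [hg, h₂]
  exact comp_zero

lemma exists_glued_triangle [IsTriangulated DX] (tZ : TStructure DZ) (tU : TStructure DU)
    (X : DX) :
    ∃ (A B : DX) (_ : tU.le 0 (R.jPull.obj A) ∧ tZ.le 0 (R.iPull.obj A))
      (_ : tU.ge 1 (R.jPull.obj B) ∧ tZ.ge 1 (R.iShriek.obj B))
      (f : A ⟶ X) (g : X ⟶ B) (h : B ⟶ A⟦(1 : ℤ)⟧), Triangle.mk f g h ∈ distTriang DX := by
  obtain ⟨P, Q, hP, hQ, f, g, h, hT⟩ := tU.exists_triangle_zero_one (R.jPull.obj X)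
  obtain ⟨Y, y, y', hY⟩ := distinguished_cocone_triangle₁ (R.jStarAdj.homEquiv _ _ g)
  obtain ⟨P', Q', hP', hQ', f', g', h', hT'⟩ := tZ.exists_triangle_zero_one (R.iPull.obj Y)
  obtain ⟨A, a, a', hA⟩ := distinguished_cocone_triangle₁ (R.iPullAdj.homEquiv _ _ g')
  obtain ⟨B, b, b', hB⟩ := distinguished_cocone_triangle (a ≫ y)
  let o := someOctahedron rfl hA hY hB
  obtain ⟨eY⟩ := nonempty_iso_of_adj R.jStarAdj hT hY
  obtain ⟨eA⟩ := nonempty_iso_of_adj R.iPullAdj hT' hA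
  -- the restriction of `A ⟶ Y` to `DU` is an isomorphism
  have i₁ : IsIso (R.jPull.map a) :=
    (Triangle.isZero₃_iff_isIso₁ _ (R.jPull.map_distinguished _ hA)).1
      (R.isZero_jPull_iStar _)
  -- the restriction of `B ⟶ j_* Q` to `DU` is an isomorphism
  have i₂ : IsIso (R.jPull.map o.m₃) :=
    (Triangle.isZero₁_iff_isIso₂ _ (R.jPull.map_distinguished _ o.mem)).1
      (R.isZero_jPull_iStar _)
  -- the functor `i^!` sends `i_* Q' ⟶ B` to an isomorphism
  have i₃ : IsIso (R.iShriek.map o.m₁) :=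
    (Triangle.isZero₃_iff_isIso₁ _ (R.iShriek.map_distinguished _ o.mem)).1
      (R.isZero_iShriek_jStar _)
  refine ⟨A, B, ⟨?_, ?_⟩, ⟨?_, ?_⟩, a ≫ y, b, b', hB⟩
  · exact (tU.le 0).prop_of_iso (asIso (R.jPull.map a) ≪≫ eY).symm hP
  · exact (tZ.le 0).prop_of_iso eA.symm hP'
  · exact (tU.ge 1).prop_of_iso
      (asIso (R.jPull.map o.m₃) ≪≫ asIso (R.jStarAdj.counit.app Q)).symm hQ
  · exact (tZ.ge 1).prop_of_iso
      (asIso (R.iShriekAdj.unit.app Q') ≪≫ asIso (R.iShriek.map o.m₁)) hQ'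

/-- The t-structure on `DX` obtained by glueing t-structures on `DZ` and `DU`:
`K` is in `DX^{≤ n}` iff `j^* K` is in `DU^{≤ n}` and `i^* K` is in `DZ^{≤ n}`, and
`K` is in `DX^{≥ n}` iff `j^* K` is in `DU^{≥ n}` and `i^! K` is in `DZ^{≥ n}`. -/
def gluedTStructure [IsTriangulated DX] (tZ : TStructure DZ) (tU : TStructure DU) :
    TStructure DX where
  le n K := tU.le n (R.jPull.obj K) ∧ tZ.le n (R.iPull.obj K)
  ge n K := tU.ge n (R.jPull.obj K) ∧ tZ.ge n (R.iShriek.obj K)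
  le_isClosedUnderIsomorphisms n :=
    ⟨fun e h ↦ ⟨(tU.le n).prop_of_iso (R.jPull.mapIso e) h.1,
      (tZ.le n).prop_of_iso (R.iPull.mapIso e) h.2⟩⟩
  ge_isClosedUnderIsomorphisms n :=
    ⟨fun e h ↦ ⟨(tU.ge n).prop_of_iso (R.jPull.mapIso e) h.1,
      (tZ.ge n).prop_of_iso (R.iShriek.mapIso e) h.2⟩⟩
  le_shift n a n' h K hK :=
    ⟨(tU.le n').prop_of_iso ((R.jPull.commShiftIso a).app K).symm (tU.le_shift n a n' h _ hK.1),
      (tZ.le n').prop_of_iso ((R.iPull.commShiftIso a).app K).symm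
        (tZ.le_shift n a n' h _ hK.2)⟩
  ge_shift n a n' h K hK :=
    ⟨(tU.ge n').prop_of_iso ((R.jPull.commShiftIso a).app K).symm (tU.ge_shift n a n' h _ hK.1),
      (tZ.ge n').prop_of_iso ((R.iShriek.commShiftIso a).app K).symm
        (tZ.ge_shift n a n' h _ hK.2)⟩
  zero' _ _ f hX hY := R.hom_eq_zero tZ tU f hX.1 hX.2 hY.1 hY.2
  le_zero_le _ h := ⟨tU.le_zero_le _ h.1, tZ.le_zero_le _ h.2⟩
  ge_one_le _ h := ⟨tU.ge_one_le _ h.1, tZ.ge_one_le _ h.2⟩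
  exists_triangle_zero_one X := R.exists_glued_triangle tZ tU X

end Recollement

end RecollementGluing

open RecollementGluing

/-! Glueing makes the three hearts `Z`, `X`, `U` into a recollement of abelian categories: each
functor is replaced by its zeroth cohomology (`Recollement.heart`). Finite length passes from `Z`
and `U` to `X` (`AbelianRecollement.hasFiniteLength`).

From `X` to `Z`: the left adjoint of the exact functor `i` preserves projectives. From `X` to `U`:
the restriction `j` need not preserve projectives, but finite length provides a projective `Q` with
an essential epimorphism onto `jl V`. Such a `Q` has no nonzero map to an object killed by `j`, and
this forces `j Q` to be projective (`AbelianRecollement.enoughProjectives_open`).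

From `Z` and `U` to `X`: `jl` preserves projectives, and `jl` of a projective cover of `j K` reaches
`K` up to a cokernel coming from `Z`. It remains to cover `i P` with `P` projective in `Z`.
Extensions of `i P` by objects from `Z` split, because `i_*` is fully faithful on the triangulated
categories. The remaining simples are the intermediate extensions of the simples of `U`: there are
finitely many, and each is a quotient of a projective. Hom-finiteness then gives a universal class
`ξ` in `Ext¹(i P, E)`, where `E` is a finite sum of these simples and is covered by a projective
`Q`.

The class `ξ` need not lift to `Q`, since there is an obstruction in `Ext²`. Instead, one takes a
quotient `N` of `Q` over `E`, with minimal kernel among those to which `ξ` lifts. The extension of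
`i P` by `N` so obtained is projective (`Heart.projective_of_minimal`): an obstruction, being an
extension of `N` by a simple object, would either split or give a larger such quotient. -/

namespace RecollementGluing

/-! ### Finite length and projective objects in abelian categories -/

section Abelian

open scoped ZeroObject

variable {A : Type u₁} [Category.{v₁} A] [Abelian A]

lemma factors_of_epi_comp {X Y Z : A} (M : Subobject X) (p : Z ⟶ Y) [Epi p] (x : Y ⟶ X)
    (h : M.Factors (p ≫ x)) : M.Factors x := by
  have := strongEpi_of_epi p
  have sq : CommSq (M.factorThru _ h) p M.arrow x := ⟨by simp⟩
  exact (Subobject.factors_iff _ _).2 ⟨sq.lift, sq.fac_right⟩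

/-- Every generalized element of `Y` lifts to `X` after a refinement, so inclusions can be tested on
preimages. Chain conditions therefore descend to quotients. -/
lemma strictMono_pullback_of_epi {X Y : A} (g : X ⟶ Y) [Epi g] :
    StrictMono (Subobject.pullback g).obj := by
  refine (Subobject.pullback g).monotone.strictMono_of_injective ?_
  have key : ∀ M N : Subobject Y, (Subobject.pullback g).obj M ≤ (Subobject.pullback g).obj N →
      M ≤ N := by
    intro M N h
    obtain ⟨B, π, hπ, x, hx⟩ := surjective_up_to_refinements_of_epi g M.arrow
    have h₁ : ((Subobject.pullback g).obj M).Factors x := by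
      rw [pullback_factors_iff, ← hx]
      exact Subobject.factors_of_factors_right _ (Subobject.factors_self M)
    have h₂ : N.Factors (π ≫ M.arrow) := by
      rw [hx, ← pullback_factors_iff]
      exact Subobject.factors_of_le x h h₁
    exact Subobject.le_of_comm (N.factorThru _ (factors_of_epi_comp N π _ h₂)) (by simp)
  exact fun M N h ↦ le_antisymm (key _ _ h.le) (key _ _ h.ge)

lemma isNoetherianObject_of_epi {X Y : A} (g : X ⟶ Y) [Epi g] [IsNoetherianObject X] :
    IsNoetherianObject Y :=
  ⟨(strictMono_pullback_of_epi g).wellFoundedGT⟩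

lemma isArtinianObject_of_epi {X Y : A} (g : X ⟶ Y) [Epi g] [IsArtinianObject X] :
    IsArtinianObject Y :=
  ⟨(strictMono_pullback_of_epi g).wellFoundedLT⟩

/-- A subobject of the middle term of an exact sequence is determined, among the comparable ones,
by its trace on the left term and its image in the right term. -/
lemma le_of_pullback_le_of_image_le {S : ShortComplex A} (hS : S.Exact) {M N : Subobject S.X₂}
    (hMN : M ≤ N) (h₁ : (Subobject.pullback S.f).obj N ≤ (Subobject.pullback S.f).obj M)
    (h₂ : imageSubobject (N.arrow ≫ S.g) ≤ imageSubobject (M.arrow ≫ S.g)) : N ≤ M := by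
  -- After a refinement, the tautological element of `N` has the same image in `S.X₃` as an element
  -- `y` of `M`. The difference lies in `N` and comes from `S.X₁`, hence lies in `M`.
  obtain ⟨B, π, hπ, y, hy⟩ := surjective_up_to_refinements_of_epi
    (factorThruImageSubobject (M.arrow ≫ S.g))
    (factorThruImageSubobject (N.arrow ≫ S.g) ≫ Subobject.ofLE _ _ h₂)
  have hy' : π ≫ N.arrow ≫ S.g = y ≫ M.arrow ≫ S.g := by
    have := congrArg (· ≫ (imageSubobject (M.arrow ≫ S.g)).arrow) hy
    simpa using this
  obtain ⟨B', π', hπ', z, hz⟩ := hS.exact_up_to_refinements (π ≫ N.arrow - y ≫ M.arrow)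
    (by simp [Preadditive.sub_comp, hy'])
  have hz' : ((Subobject.pullback S.f).obj N).Factors z := by
    rw [pullback_factors_iff, ← hz]
    refine Subobject.factors_of_factors_right _ ?_
    rw [sub_eq_add_neg, ← Preadditive.neg_comp]
    exact Subobject.factors_add _ _ (Subobject.factors_of_factors_right _ (Subobject.factors_self N))
      (Subobject.factors_of_factors_right _ (Subobject.factors_of_le _ hMN
        (Subobject.factors_self M)))
  have hz'' : M.Factors (z ≫ S.f) :=
    (pullback_factors_iff _ _ _).1 (Subobject.factors_of_le _ h₁ hz')
  have h₃ : M.Factors ((π' ≫ π) ≫ N.arrow) := by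
    have : (π' ≫ π) ≫ N.arrow = z ≫ S.f + (π' ≫ y) ≫ M.arrow := by
      rw [← hz]; simp
    rw [this]
    exact Subobject.factors_add _ _ hz''
      (Subobject.factors_of_factors_right _ (Subobject.factors_self M))
  exact Subobject.le_of_comm (M.factorThru _ (factors_of_epi_comp M (π' ≫ π) _ h₃)) (by simp)

lemma imageSubobject_arrow_comp_mono {X Y : A} (g : X ⟶ Y) {M N : Subobject X} (h : M ≤ N) :
    imageSubobject (M.arrow ≫ g) ≤ imageSubobject (N.arrow ≫ g) := by
  have : M.arrow ≫ g = Subobject.ofLE M N h ≫ N.arrow ≫ g := by simp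
  rw [this]
  exact imageSubobject_comp_le _ _

lemma strictMono_pullback_prod_image {S : ShortComplex A} (hS : S.Exact) :
    StrictMono fun M : Subobject S.X₂ ↦
      ((Subobject.pullback S.f).obj M, imageSubobject (M.arrow ≫ S.g)) := by
  intro M N h
  refine lt_of_le_of_ne ⟨(Subobject.pullback S.f).monotone h.le,
    imageSubobject_arrow_comp_mono _ h.le⟩ fun e ↦ h.not_ge ?_
  rw [Prod.ext_iff] at e
  exact le_of_pullback_le_of_image_le hS h.le e.1.ge e.2.ge

lemma isNoetherianObject_of_exact {S : ShortComplex A} (hS : S.Exact) [IsNoetherianObject S.X₁]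
    [IsNoetherianObject S.X₃] : IsNoetherianObject S.X₂ :=
  ⟨(strictMono_pullback_prod_image hS).wellFoundedGT⟩

lemma isArtinianObject_of_exact {S : ShortComplex A} (hS : S.Exact) [IsArtinianObject S.X₁]
    [IsArtinianObject S.X₃] : IsArtinianObject S.X₂ :=
  ⟨(strictMono_pullback_prod_image hS).wellFoundedLT⟩

/-- An object has *finite length* if it is noetherian and artinian. -/
def HasFiniteLength {A : Type u₁} [Category.{v₁} A] (X : A) : Prop :=
  IsNoetherianObject X ∧ IsArtinianObject X

omit [Abelian A] in
lemma HasFiniteLength.of_mono {X Y : A} (f : X ⟶ Y) [Mono f] (h : HasFiniteLength Y) :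
    HasFiniteLength X :=
  have := h.1
  have := h.2
  ⟨isNoetherianObject_of_mono f, isArtinianObject_of_mono f⟩

lemma HasFiniteLength.of_epi {X Y : A} (f : X ⟶ Y) [Epi f] (h : HasFiniteLength X) :
    HasFiniteLength Y :=
  have := h.1
  have := h.2
  ⟨isNoetherianObject_of_epi f, isArtinianObject_of_epi f⟩

lemma HasFiniteLength.of_exact {S : ShortComplex A} (hS : S.Exact) (h₁ : HasFiniteLength S.X₁)
    (h₃ : HasFiniteLength S.X₃) : HasFiniteLength S.X₂ :=
  have := h₁.1
  have := h₁.2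
  have := h₃.1
  have := h₃.2
  ⟨isNoetherianObject_of_exact hS, isArtinianObject_of_exact hS⟩

lemma HasFiniteLength.of_simple (X : A) [Simple X] : HasFiniteLength X := by
  have : Finite (Subobject X) :=
    Finite.of_surjective (fun b : Bool ↦ if b then (⊤ : Subobject X) else ⊥) fun M ↦ by
      obtain rfl | rfl := eq_bot_or_eq_top M
      exacts [⟨false, by simp⟩, ⟨true, by simp⟩]
  constructor
  · exact ⟨show WellFoundedGT (Subobject X) from inferInstance⟩
  · exact ⟨show WellFoundedLT (Subobject X) from inferInstance⟩

/-- A property of objects which is stable under extensions and holds for zero objects and for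
simple objects holds for all objects of finite length. -/
lemma HasFiniteLength.induction {P : A → Prop} (zero : ∀ X, IsZero X → P X)
    (simple : ∀ X, Simple X → P X)
    (ext : ∀ S : ShortComplex A, S.ShortExact → P S.X₁ → P S.X₃ → P S.X₂)
    {X : A} (hX : HasFiniteLength X) : P X := by
  have := hX.1
  have := hX.2
  have iso : ∀ {Y Z : A}, (Y ≅ Z) → P Y → P Z := by
    intro Y Z e hY
    refine ext (ShortComplex.mk e.hom (0 : Z ⟶ 0) comp_zero) ?_ hY (zero _ (isZero_zero A))
    exact { exact := (ShortComplex.exact_iff_epi _ rfl).2 (inferInstanceAs (Epi e.hom))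
            mono_f := inferInstanceAs (Mono e.hom)
            epi_g := ⟨fun _ _ _ ↦ (isZero_zero A).eq_of_src _ _⟩ }
  -- Take a maximal subobject `M` satisfying `P`. If `M` is proper, the preimage of a simple
  -- subobject of the cokernel is a larger one.
  obtain ⟨M, hM, hmax⟩ := (wellFounded_gt (α := Subobject X)).has_min
    {M | P (M : A)} ⟨⊥, zero _ (by
      exact (isZero_zero A).of_iso Subobject.botCoeIsoZero)⟩
  by_contra hPX
  have hMX : ¬ IsZero (cokernel M.arrow) := fun h ↦ by
    have : Epi M.arrow := Preadditive.epi_of_isZero_cokernel _ h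
    have : IsIso M.arrow := isIso_of_mono_of_epi _
    exact hPX (iso (asIso M.arrow) hM)
  have : IsArtinianObject (cokernel M.arrow) := isArtinianObject_of_epi (cokernel.π M.arrow)
  obtain ⟨N, hN⟩ := exists_simple_subobject hMX
  let M' : Subobject X := (Subobject.pullback (cokernel.π M.arrow)).obj N
  have hMM' : M ≤ M' := by
    have h : M'.Factors M.arrow := by
      rw [pullback_factors_iff, cokernel.condition]
      exact Subobject.factors_zero
    exact Subobject.le_of_comm (M'.factorThru M.arrow h) (Subobject.factorThru_arrow _ _ h)
  let p : (M' : A) ⟶ (N : A) := Subobject.pullbackπ _ N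
  have hp : p ≫ N.arrow = M'.arrow ≫ cokernel.π M.arrow :=
    (Subobject.isPullback (cokernel.π M.arrow) N).w
  have hp' : Epi p := by
    exact Abelian.epi_fst_of_isLimit _ _ (Subobject.isPullback (cokernel.π M.arrow) N).isLimit
  have hz : Subobject.ofLE M M' hMM' ≫ p = 0 := by
    rw [← cancel_mono N.arrow]
    simp [hp]
  have hP' : P (M' : A) := by
    refine ext (ShortComplex.mk _ _ hz) ?_ hM (simple _ hN)
    refine { exact := ?_, mono_f := inferInstanceAs (Mono (Subobject.ofLE M M' hMM')),
             epi_g := hp' }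
    rw [ShortComplex.exact_iff_exact_up_to_refinements]
    intro B x hx
    have h₀ : (x ≫ M'.arrow) ≫ cokernel.π M.arrow = 0 := by
      rw [Category.assoc, ← hp]
      dsimp at hx
      rw [reassoc_of% hx, zero_comp]
    refine ⟨B, 𝟙 B, inferInstance, Abelian.monoLift M.arrow _ h₀, ?_⟩
    rw [← cancel_mono M'.arrow]
    dsimp only
    rw [Category.id_comp, Category.assoc, Subobject.ofLE_arrow, Abelian.monoLift_comp]
  refine hmax M' hP' (lt_of_le_of_ne hMM' fun h ↦ Simple.not_isZero (N : A) ?_)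
  have h₁ : M'.arrow ≫ cokernel.π M.arrow = 0 := by
    have := Subobject.ofLE_arrow h.ge
    rw [← this, Category.assoc, cokernel.condition, comp_zero]
  have h₂ : p = 0 := by
    rw [← cancel_mono N.arrow, hp, h₁, zero_comp]
  rw [IsZero.iff_id_eq_zero, ← cancel_epi p, h₂, zero_comp, zero_comp]

/-- An epimorphic endomorphism of a noetherian object is an isomorphism. -/
lemma isIso_of_epi_endomorphism {X : A} [IsNoetherianObject X] (f : X ⟶ X) [Epi f] : IsIso f := by
  let g : ℕ → (X ⟶ X) := fun n ↦ (fun h : X ⟶ X ↦ h ≫ f)^[n] (𝟙 X)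
  have hg : ∀ n, g (n + 1) = g n ≫ f := fun n ↦ Function.iterate_succ_apply' _ n _
  have hepi : ∀ n, Epi (g n) := fun n ↦ by
    induction n with
    | zero => exact inferInstanceAs (Epi (𝟙 X))
    | succ n ih => rw [hg]; exact epi_comp _ _
  -- The kernels of the iterates `g n = fⁿ` stabilize. An element killed by `f` is locally of the
  -- form `fⁿ y`; then `y` is killed by `fⁿ⁺¹`, hence by `fⁿ`.
  let K : ℕ → Subobject X := fun n ↦ kernelSubobject (g n)
  have hmono : Monotone K := by
    refine monotone_nat_of_le_succ fun n ↦ le_kernelSubobject (g (n + 1)) _ ?_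
    rw [hg, kernelSubobject_arrow_comp_assoc, zero_comp]
  obtain ⟨n, hn⟩ := monotone_chain_condition_of_isNoetherianObject ⟨_, hmono⟩
  have : Mono f := by
    refine Preadditive.mono_of_cancel_zero _ fun {B} x hx ↦ ?_
    have := hepi n
    obtain ⟨B', π, hπ, y, hy⟩ := surjective_up_to_refinements_of_epi (g n) x
    have h₁ : (kernelSubobject (g (n + 1))).Factors y :=
      kernelSubobject_factors _ _ (by
        rw [hg, ← Category.assoc, ← hy, Category.assoc, hx, comp_zero])
    have h₂ : kernelSubobject (g n) = kernelSubobject (g (n + 1)) := hn (n + 1) n.le_succ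
    have h₃ : (kernelSubobject (g n)).Factors y := h₂ ▸ h₁
    rw [← cancel_epi π, hy, (kernelSubobject_factors_iff _ _).1 h₃, comp_zero]
  exact isIso_of_mono_of_epi f

/-- A quotient of a projective object of finite length is the quotient of a projective object by
a superfluous subobject. -/
lemma exists_essential_projective {P X : A} [Projective P] (hP : HasFiniteLength P) (p : P ⟶ X)
    [Epi p] : ∃ (P' : A) (_ : Projective P') (p' : P' ⟶ X) (_ : Epi p'),
      ∀ ⦃Y : A⦄ (m : Y ⟶ P') [Mono m], Epi (m ≫ p') → IsIso m := by
  have := hP.1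
  have := hP.2
  -- A minimal subobject of `P` surjecting onto `X`; minimality is the essential property, and `M`
  -- turns out to be a retract of `P`.
  obtain ⟨M, hM, hmin⟩ := (wellFounded_lt (α := Subobject P)).has_min
    {M | Epi (M.arrow ≫ p)} ⟨⊤, epi_comp _ _⟩
  have hM : Epi (M.arrow ≫ p) := hM
  have ess : ∀ ⦃Y : A⦄ (m : Y ⟶ (M : A)) [Mono m], Epi (m ≫ M.arrow ≫ p) → IsIso m := by
    intro Y m _ h
    let N := Subobject.mk (m ≫ M.arrow)
    have hNM : N ≤ M := Subobject.mk_le_of_comm m rfl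
    have hN : Epi (N.arrow ≫ p) := by
      have : Epi ((Subobject.underlyingIso (m ≫ M.arrow)).hom ≫ m ≫ M.arrow ≫ p) := epi_comp _ _
      rw [← Category.assoc, ← Category.assoc, Category.assoc _ m,
        Subobject.underlyingIso_hom_comp_eq_mk] at this
      exact this
    have hle : M ≤ N := by
      by_contra h'
      exact hmin N hN (lt_of_le_not_ge hNM h')
    have : Epi m := by
      have h₁ : (Subobject.ofLE M N hle ≫ (Subobject.underlyingIso (m ≫ M.arrow)).hom) ≫ m
          = 𝟙 _ := by
        rw [← cancel_mono M.arrow]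
        simp only [Category.assoc, Subobject.underlyingIso_hom_comp_eq_mk, Category.id_comp]
        exact Subobject.ofLE_arrow hle
      exact epi_of_epi_fac h₁
    exact isIso_of_mono_of_epi m
  refine ⟨M, ?_, M.arrow ≫ p, hM, ess⟩
  let s : P ⟶ (M : A) := Projective.factorThru p (M.arrow ≫ p)
  have hs : s ≫ M.arrow ≫ p = p := Projective.factorThru_comp _ _
  -- This endomorphism of `M` is compatible with the map to `X`, so its image still surjects onto
  -- `X` and is all of `M`.
  have hs' : Epi (M.arrow ≫ s) := by
    have h₁ : Epi (image.ι (M.arrow ≫ s) ≫ M.arrow ≫ p) := by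
      have : factorThruImage (M.arrow ≫ s) ≫ image.ι (M.arrow ≫ s) ≫ M.arrow ≫ p
          = M.arrow ≫ p := by
        simp only [image.fac_assoc, Category.assoc, hs]
      exact epi_of_epi_fac this
    have := ess _ h₁
    rw [← image.fac (M.arrow ≫ s)]
    exact epi_comp _ _
  have : IsNoetherianObject (M : A) := isNoetherianObject_of_mono M.arrow
  have := isIso_of_epi_endomorphism (M.arrow ≫ s)
  exact Retract.projective (Y := P)
    { i := M.arrow, r := s ≫ inv (M.arrow ≫ s), retract := by rw [← Category.assoc]; simp }

end Abelian

/-! ### Recollements of abelian categories -/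

lemma unit_comp_map_homEquiv_symm {C : Type u₁} [Category.{v₁} C] {D : Type u₂} [Category.{v₂} D]
    {F : C ⥤ D} {G : D ⥤ C} (adj : F ⊣ G) {V : C} {K : D} (f : V ⟶ G.obj K) :
    adj.unit.app V ≫ G.map ((adj.homEquiv V K).symm f) = f :=
  (adj.homEquiv_unit _ _ _).symm.trans (Equiv.apply_symm_apply _ _)

lemma map_homEquiv_comp_counit {C : Type u₁} [Category.{v₁} C] {D : Type u₂} [Category.{v₂} D]
    {F : C ⥤ D} {G : D ⥤ C} (adj : F ⊣ G) {V : C} {K : D} (f : F.obj V ⟶ K) :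
    F.map (adj.homEquiv V K f) ≫ adj.counit.app K = f :=
  (adj.homEquiv_counit _ _ _).symm.trans (Equiv.symm_apply_apply _ _)

/-- A recollement of abelian categories. -/
structure AbelianRecollement (Z : Type u₁) [Category.{v₁} Z] [Abelian Z]
    (X : Type u₂) [Category.{v₂} X] [Abelian X] (U : Type u₃) [Category.{v₃} U] [Abelian U] where
  /-- the inclusion of the closed part -/
  i : Z ⥤ X
  /-- the restriction to the open part -/
  j : X ⥤ U
  /-- the left adjoint of `i` -/
  il : X ⥤ Z
  /-- the right adjoint of `i` -/
  ir : X ⥤ Z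
  /-- the left adjoint of `j` -/
  jl : U ⥤ X
  /-- the right adjoint of `j` -/
  jr : U ⥤ X
  /-- the adjunction between `il` and `i` -/
  ilAdj : il ⊣ i
  /-- the adjunction between `i` and `ir` -/
  irAdj : i ⊣ ir
  /-- the adjunction between `jl` and `j` -/
  jlAdj : jl ⊣ j
  /-- the adjunction between `j` and `jr` -/
  jrAdj : j ⊣ jr
  [i_additive : i.Additive]
  [j_additive : j.Additive]
  [i_full : i.Full]
  [i_faithful : i.Faithful]
  isZero_j_i (W : Z) : IsZero (j.obj (i.obj W))
  exists_iso (K : X) (hK : IsZero (j.obj K)) : ∃ W, Nonempty (i.obj W ≅ K)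
  isIso_jlAdj_unit_app (V : U) : IsIso (jlAdj.unit.app V)

namespace AbelianRecollement

variable {Z : Type u₁} [Category.{v₁} Z] [Abelian Z]
  {X : Type u₂} [Category.{v₂} X] [Abelian X] {U : Type u₃} [Category.{v₃} U] [Abelian U]
  (R : AbelianRecollement Z X U)

attribute [instance] i_additive j_additive i_full i_faithful isIso_jlAdj_unit_app

instance : R.i.IsLeftAdjoint := R.irAdj.isLeftAdjoint
instance : R.i.IsRightAdjoint := R.ilAdj.isRightAdjoint
instance : R.j.IsLeftAdjoint := R.jrAdj.isLeftAdjoint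
instance : R.j.IsRightAdjoint := R.jlAdj.isRightAdjoint
instance : R.il.IsLeftAdjoint := R.ilAdj.isLeftAdjoint
instance : R.jl.IsLeftAdjoint := R.jlAdj.isLeftAdjoint
instance : R.jr.IsRightAdjoint := R.jrAdj.isRightAdjoint
instance : R.jl.Additive := R.jlAdj.left_adjoint_additive

instance : IsIso R.jlAdj.unit := NatIso.isIso_of_isIso_app _

instance : IsIso R.jrAdj.counit :=
  (Adjunction.Triple.mk R.jlAdj R.jrAdj).isIso_unit_iff_isIso_counit.1
    (inferInstanceAs (IsIso R.jlAdj.unit))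

instance (V : U) : IsIso (R.jrAdj.counit.app V) := inferInstance

lemma jl_hom_eq_zero {V : U} {K : X} (hK : IsZero (R.j.obj K)) (f : R.jl.obj V ⟶ K) : f = 0 :=
  (R.jlAdj.homEquiv _ _).injective (hK.eq_of_tgt _ _)

lemma jr_hom_eq_zero {V : U} {K : X} (hK : IsZero (R.j.obj K)) (f : K ⟶ R.jr.obj V) : f = 0 :=
  (R.jrAdj.homEquiv _ _).symm.injective (hK.eq_of_src _ _)

lemma isZero_j_of_epi {K L : X} (f : K ⟶ L) [Epi f] (hf : R.j.map f = 0) :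
    IsZero (R.j.obj L) := by
  rw [IsZero.iff_id_eq_zero, ← cancel_epi (R.j.map f), hf, zero_comp, zero_comp]

lemma isZero_j_of_mono {K L : X} (f : K ⟶ L) [Mono f] (hf : R.j.map f = 0) :
    IsZero (R.j.obj K) := by
  rw [IsZero.iff_id_eq_zero, ← cancel_mono (R.j.map f), hf, comp_zero, comp_zero]

lemma isZero_j_cokernel {K L : X} (f : K ⟶ L) [Epi (R.j.map f)] :
    IsZero (R.j.obj (cokernel f)) := by
  refine R.isZero_j_of_epi (cokernel.π f) ?_
  rw [← cancel_epi (R.j.map f), ← R.j.map_comp, cokernel.condition, R.j.map_zero, comp_zero]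

lemma isZero_j_kernel {K L : X} (f : K ⟶ L) [Mono (R.j.map f)] :
    IsZero (R.j.obj (kernel f)) := by
  refine R.isZero_j_of_mono (kernel.ι f) ?_
  rw [← cancel_mono (R.j.map f), ← R.j.map_comp, kernel.condition, R.j.map_zero, zero_comp]

/-- The canonical morphism from the left extension to the right extension. -/
noncomputable def canonical (V : U) : R.jl.obj V ⟶ R.jr.obj V :=
  R.jrAdj.homEquiv _ _ (inv (R.jlAdj.unit.app V))

instance (V : U) : IsIso (R.j.map (R.canonical V)) := by
  have h : R.j.map (R.canonical V) ≫ R.jrAdj.counit.app V = inv (R.jlAdj.unit.app V) :=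
    map_homEquiv_comp_counit _ _
  have : IsIso (R.j.map (R.canonical V) ≫ R.jrAdj.counit.app V) := by rw [h]; infer_instance
  exact IsIso.of_isIso_comp_right _ (R.jrAdj.counit.app V)

/-- The intermediate extension of an object of `U`. -/
noncomputable abbrev middle (V : U) : X := image (R.canonical V)

lemma map_canonical_fac (V : U) : R.j.map (factorThruImage (R.canonical V)) ≫
    R.j.map (image.ι (R.canonical V)) = R.j.map (R.canonical V) := by
  rw [← R.j.map_comp, image.fac]

instance (V : U) : IsIso (R.j.map (factorThruImage (R.canonical V))) := by
  have : Mono (R.j.map (factorThruImage (R.canonical V))) := by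
    have : Mono (R.j.map (factorThruImage (R.canonical V)) ≫
      R.j.map (image.ι (R.canonical V))) := by rw [map_canonical_fac]; infer_instance
    exact mono_of_mono _ (R.j.map (image.ι (R.canonical V)))
  exact isIso_of_mono_of_epi _

/-- The intermediate extension restricts to the given object. -/
noncomputable def jMiddleIso (V : U) : V ≅ R.j.obj (R.middle V) :=
  asIso (R.jlAdj.unit.app V) ≪≫ asIso (R.j.map (factorThruImage (R.canonical V)))

/-- A subobject of `i S` is killed by the exact functor `j`, so it comes from `Z`; full faithfulness
then reduces to the simplicity of `S`. -/
lemma simple_i_obj (S : Z) [Simple S] : Simple (R.i.obj S) := by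
  refine ⟨fun {Y} m _ ↦ ⟨fun _ hm ↦ ?_, fun hm ↦ ?_⟩⟩
  · refine Simple.not_isZero S ?_
    rw [IsZero.iff_id_eq_zero]
    apply R.i.map_injective
    rw [R.i.map_id, R.i.map_zero, ← cancel_epi m, hm, zero_comp, zero_comp]
  · obtain ⟨W, ⟨e⟩⟩ := R.exists_iso Y (R.isZero_j_of_mono m ((R.isZero_j_i S).eq_of_tgt _ _))
    obtain ⟨a, ha⟩ := R.i.map_surjective (e.hom ≫ m)
    have : Mono (R.i.map a) := by rw [ha]; exact mono_comp _ _
    have : Mono a := R.i.mono_of_mono_map inferInstance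
    have ha₀ : a ≠ 0 := by
      rintro rfl
      rw [R.i.map_zero] at ha
      exact hm (by rw [← cancel_epi e.hom, ← ha, comp_zero])
    have := isIso_of_mono_of_nonzero ha₀
    have : IsIso (e.hom ≫ m) := by rw [← ha]; infer_instance
    exact IsIso.of_isIso_comp_left e.hom m

/-- The intermediate extension is a quotient of `jl V` and a subobject of `jr V`, so it has no
nonzero quotient or subobject killed by `j`. A nonzero subobject thus restricts to a nonzero
subobject of the simple `V`, and its cokernel, being killed by `j`, vanishes. -/
lemma simple_middle (V : U) [Simple V] : Simple (R.middle V) := by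
  have hV : Simple (R.j.obj (R.middle V)) := Simple.of_iso (R.jMiddleIso V).symm
  refine ⟨fun {Y} m _ ↦ ⟨fun _ hm ↦ ?_, fun hm ↦ ?_⟩⟩
  · refine Simple.not_isZero (R.j.obj (R.middle V)) ?_
    rw [IsZero.iff_id_eq_zero, ← R.j.map_id, show 𝟙 (R.middle V) = 0 by
      rw [← cancel_epi m, hm, zero_comp, zero_comp], R.j.map_zero]
  · have hjm : R.j.map m ≠ 0 := fun h ↦ by
      have h₁ := R.jr_hom_eq_zero (R.isZero_j_of_mono m h) (m ≫ image.ι (R.canonical V))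
      exact hm (by rw [← cancel_mono (image.ι (R.canonical V)), h₁, zero_comp])
    have := isIso_of_mono_of_nonzero hjm
    have h₂ : factorThruImage (R.canonical V) ≫ cokernel.π m = 0 :=
      R.jl_hom_eq_zero (R.isZero_j_cokernel m) _
    have h₃ : cokernel.π m = 0 := by
      rw [← cancel_epi (factorThruImage (R.canonical V)), h₂, comp_zero]
    have : Epi m := Preadditive.epi_of_cokernel_zero h₃
    exact isIso_of_mono_of_epi m

section Simple

variable (K : X) [Simple K] (hK : ¬ IsZero (R.j.obj K))

-- A nonzero subobject `V` of `j K` corresponds to a nonzero map `jl V ⟶ K`, which is epi; applying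
-- `j` shows that `V` is everything.
include hK in
lemma simple_j_obj : Simple (R.j.obj K) := by
  refine ⟨fun {V} m _ ↦ ⟨fun _ hm ↦ ?_, fun hm ↦ ?_⟩⟩
  · refine hK ?_
    rw [IsZero.iff_id_eq_zero, ← cancel_epi m, hm, zero_comp, zero_comp]
  · have h₀ : (R.jlAdj.homEquiv _ _).symm m ≠ 0 := fun h ↦ by
      rw [Equiv.symm_apply_eq, R.jlAdj.homEquiv_unit, R.j.map_zero, comp_zero] at h
      exact hm h
    have := epi_of_nonzero_to_simple h₀
    have h₁ : R.jlAdj.unit.app V ≫ R.j.map ((R.jlAdj.homEquiv _ _).symm m) = m :=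
      unit_comp_map_homEquiv_symm _ _
    have : Epi m := by rw [← h₁]; exact epi_comp _ _
    exact isIso_of_mono_of_epi m

include hK in
/-- A simple object with nonzero restriction to `U` is the intermediate extension of its
restriction. -/
lemma nonempty_iso_middle {V : U} (e : V ≅ R.j.obj K) : Nonempty (K ≅ R.middle V) := by
  let p : R.jl.obj V ⟶ K := (R.jlAdj.homEquiv _ _).symm e.hom
  let m : K ⟶ R.jr.obj V := R.jrAdj.homEquiv _ _ e.inv
  have hp : R.jlAdj.unit.app V ≫ R.j.map p = e.hom :=
    unit_comp_map_homEquiv_symm _ _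
  have hm : R.j.map m ≫ R.jrAdj.counit.app V = e.inv :=
    map_homEquiv_comp_counit _ _
  have hp₀ : p ≠ 0 := fun h ↦ hK <| by
    rw [IsZero.iff_id_eq_zero, ← e.inv_hom_id, ← hp, h, R.j.map_zero, comp_zero, comp_zero]
  have hm₀ : m ≠ 0 := fun h ↦ hK <| by
    rw [IsZero.iff_id_eq_zero, ← e.inv_hom_id, ← hm, h, R.j.map_zero, zero_comp, zero_comp]
  have : Epi p := epi_of_nonzero_to_simple hp₀
  have : Mono m := Preadditive.mono_of_kernel_zero (kernel_zero_of_nonzero_from_simple hm₀)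
  have := strongEpi_of_epi p
  -- Image factorizations are unique, so it suffices that `p ≫ m` is the canonical morphism; this is
  -- checked on its transpose.
  refine ⟨image.isoStrongEpiMono p m ?_⟩
  apply (R.jrAdj.homEquiv _ _).symm.injective
  rw [R.jrAdj.homEquiv_naturality_left_symm, canonical, Equiv.symm_apply_apply,
    Equiv.symm_apply_apply, ← cancel_epi (R.jlAdj.unit.app V), reassoc_of% hp, e.hom_inv_id,
    IsIso.hom_inv_id]
  rfl

end Simple

lemma hasFiniteLength_i_obj {W : Z} (hW : HasFiniteLength W) : HasFiniteLength (R.i.obj W) := by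
  refine HasFiniteLength.induction (P := fun W ↦ HasFiniteLength (R.i.obj W)) ?_ ?_ ?_ hW
  · intro W hW
    have := R.i.map_isZero hW
    exact ⟨isNoetherianObject_of_isZero this, isArtinianObject_of_isZero this⟩
  · intro S _
    have := R.simple_i_obj S
    exact .of_simple _
  · intro S hS h₁ h₃
    exact .of_exact (hS.map_of_exact R.i).exact h₁ h₃

lemma hasFiniteLength_of_isZero_j (hZ : ∀ W : Z, HasFiniteLength W) {K : X}
    (hK : IsZero (R.j.obj K)) : HasFiniteLength K := by
  obtain ⟨W, ⟨e⟩⟩ := R.exists_iso K hK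
  exact .of_mono e.inv (R.hasFiniteLength_i_obj (hZ W))

/-- Since `jl` is right exact, induction on length reduces to simple `V`. There `jl V` is an
extension of the simple intermediate extension by an object killed by `j`. -/
lemma hasFiniteLength_jl_obj (hZ : ∀ W : Z, HasFiniteLength W) {V : U} (hV : HasFiniteLength V) :
    HasFiniteLength (R.jl.obj V) := by
  refine HasFiniteLength.induction (P := fun V ↦ HasFiniteLength (R.jl.obj V)) ?_ ?_ ?_ hV
  · intro V hV
    have := R.jl.map_isZero hV
    exact ⟨isNoetherianObject_of_isZero this, isArtinianObject_of_isZero this⟩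
  · intro V _
    have := R.simple_middle V
    let p := factorThruImage (R.canonical V)
    have hp : (ShortComplex.mk _ _ (kernel.condition p)).Exact :=
      ShortComplex.exact_kernel p
    exact .of_exact hp (R.hasFiniteLength_of_isZero_j hZ (R.isZero_j_kernel p)) (.of_simple _)
  · intro S hS h₁ h₃
    have := hS.epi_g
    exact .of_exact (hS.exact.map_of_epi_of_preservesCokernel R.jl inferInstance inferInstance)
      h₁ h₃

include R in
/-- In a recollement of abelian categories, the middle category is a length category if the outer
ones are. -/
theorem hasFiniteLength (hZ : ∀ W : Z, HasFiniteLength W) (hU : ∀ V : U, HasFiniteLength V)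
    (K : X) : HasFiniteLength K := by
  -- The counit becomes invertible under `j`, so its cokernel comes from `Z`, while its image is a
  -- quotient of `jl (j K)`.
  let p := R.jlAdj.counit.app K
  have : IsIso (R.j.map p) := by
    have := R.jlAdj.right_triangle_components K
    exact (IsIso.eq_inv_of_hom_inv_id this) ▸ inferInstance
  have hK : (ShortComplex.mk (image.ι p) (cokernel.π p) (by
      rw [← cancel_epi (factorThruImage p), image.fac_assoc, cokernel.condition,
        comp_zero])).Exact := by
    rw [ShortComplex.exact_iff_exact_up_to_refinements]
    intro B x hx
    have h : (ShortComplex.mk _ _ (cokernel.condition p)).Exact :=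
      ShortComplex.exact_cokernel p
    obtain ⟨B', π, hπ, y, hy⟩ := h.exact_up_to_refinements x hx
    exact ⟨B', π, hπ, y ≫ factorThruImage p, by simpa using hy⟩
  exact .of_exact hK (.of_epi (factorThruImage p) (R.hasFiniteLength_jl_obj hZ (hU _)))
    (R.hasFiniteLength_of_isZero_j hZ (R.isZero_j_cokernel p))

-- The functor `il` preserves projectives because its right adjoint `i` preserves epimorphisms, and
-- `il (i W) ≅ W` because `i` is fully faithful.
include R in
theorem enoughProjectives_closed [EnoughProjectives X] : EnoughProjectives Z where
  presentation W := by
    obtain ⟨P⟩ := EnoughProjectives.presentation (R.i.obj W)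
    exact ⟨{ p := R.il.obj P.p
             projective := R.ilAdj.map_projective _ P.projective
             f := R.il.map P.f ≫ R.ilAdj.counit.app W
             epi := epi_comp _ _ }⟩

-- The functor `jr` is not right exact, so `j` need not preserve projectives. It does send to a
-- projective any projective `Q` without nonzero maps to objects killed by `j`.
include R in
theorem enoughProjectives_open (hX : ∀ K : X, HasFiniteLength K) [EnoughProjectives X] :
    EnoughProjectives U where
  presentation V := by
    obtain ⟨P⟩ := EnoughProjectives.presentation (R.jl.obj V)
    obtain ⟨Q, hQ, q, hq, ess⟩ := exists_essential_projective (hX P.p) P.f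
    have key : ∀ {K : X} (_ : IsZero (R.j.obj K)) (f : Q ⟶ K), f = 0 := by
      intro K hK f
      -- If `x` vanishes on the kernel of `f`, then `q ≫ x` factors through the image of `f`, so `j`
      -- kills `x`; a map out of `jl V` killed by `j` is zero. Essentiality of `q` then makes the
      -- kernel of `f` all of `Q`.
      have h : Epi (kernel.ι f ≫ q) := by
        refine Preadditive.epi_of_cancel_zero _ fun {T} x hx ↦ ?_
        rw [Category.assoc] at hx
        have h₀ : kernel.ι (factorThruImage f) ≫ q ≫ x = 0 := by
          have : kernel.ι (factorThruImage f) ≫ f = 0 := by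
            conv_lhs => arg 2; rw [← image.fac f]
            rw [kernel.condition_assoc, zero_comp]
          rw [← kernel.lift_ι f _ this, Category.assoc, hx, comp_zero]
        have h₁ : factorThruImage f ≫ Abelian.epiDesc (factorThruImage f) (q ≫ x) h₀ = q ≫ x :=
          Abelian.comp_epiDesc _ _ _
        have h₂ : IsZero (R.j.obj (image f)) :=
          R.isZero_j_of_mono (image.ι f) (hK.eq_of_tgt _ _)
        have h₃ : R.j.map x = 0 := by
          rw [← cancel_epi (R.j.map q), ← R.j.map_comp, ← h₁, R.j.map_comp, comp_zero,
            h₂.eq_of_tgt (R.j.map (factorThruImage f)) 0, zero_comp]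
        apply (R.jlAdj.homEquiv _ _).injective
        rw [R.jlAdj.homEquiv_unit, R.jlAdj.homEquiv_unit, h₃, R.j.map_zero]
      have := ess _ h
      rw [← cancel_epi (kernel.ι f), kernel.condition, comp_zero]
    refine ⟨{ p := R.j.obj Q, projective := ⟨fun {V₁ V₂} f e _ ↦ ?_⟩,
              f := R.j.map q ≫ inv (R.jlAdj.unit.app V), epi := epi_comp _ _ }⟩
    have : Epi (R.j.map (R.jr.map e)) := by
      have h : R.j.map (R.jr.map e) ≫ R.jrAdj.counit.app V₂ = R.jrAdj.counit.app V₁ ≫ e :=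
        R.jrAdj.counit.naturality e
      have : Epi (R.j.map (R.jr.map e) ≫ R.jrAdj.counit.app V₂) := by
        rw [h]
        exact epi_comp _ _
      exact ((MorphismProperty.epimorphisms U).cancel_right_of_respectsIso _ _).1 this
    -- The transpose of `f` has zero component in the cokernel of `jr e`, so projectivity of `Q`
    -- lifts it through `jr e`.
    have hC := key (R.isZero_j_cokernel (R.jr.map e))
      (R.jrAdj.homEquiv _ _ f ≫ cokernel.π (R.jr.map e))
    have hE : (ShortComplex.mk _ _ (cokernel.condition (R.jr.map e))).Exact :=
      ShortComplex.exact_cokernel _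
    refine ⟨(R.jrAdj.homEquiv _ _).symm (hE.liftFromProjective _ hC), ?_⟩
    rw [← R.jrAdj.homEquiv_naturality_right_symm, Equiv.symm_apply_eq]
    exact hE.liftFromProjective_comp _ hC

/-- A projective over `j K` yields a map to `K` whose cokernel comes from `Z`. Lifting a projective
cover of that cokernel to `K` supplies what is missing. -/
theorem enoughProjectives_of_exists [EnoughProjectives U]
    (h : ∀ W : Z, ∃ (P : X) (_ : Projective P) (p : P ⟶ R.i.obj W), Epi p) :
    EnoughProjectives X where
  presentation K := by
    obtain ⟨Q⟩ := EnoughProjectives.presentation (R.j.obj K)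
    let a : R.jl.obj Q.p ⟶ K := (R.jlAdj.homEquiv _ _).symm Q.f
    have ha : R.jlAdj.unit.app Q.p ≫ R.j.map a = Q.f :=
      unit_comp_map_homEquiv_symm _ _
    have : Epi (R.j.map a) := epi_of_epi_fac ha
    obtain ⟨W, ⟨e⟩⟩ := R.exists_iso _ (R.isZero_j_cokernel a)
    obtain ⟨P, hP, p, hp⟩ := h W
    let b : P ⟶ K := Projective.factorThru (p ≫ e.hom) (cokernel.π a)
    have hb : b ≫ cokernel.π a = p ≫ e.hom := Projective.factorThru_comp _ _
    have := R.jlAdj.map_projective _ Q.projective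
    refine ⟨{ p := R.jl.obj Q.p ⊞ P, f := biprod.desc a b, epi := ?_ }⟩
    refine Preadditive.epi_of_cancel_zero _ fun {T} x hx ↦ ?_
    have h₁ : a ≫ x = 0 := by simpa using congrArg (biprod.inl ≫ ·) hx
    have h₂ : b ≫ x = 0 := by simpa using congrArg (biprod.inr ≫ ·) hx
    have h₃ : cokernel.π a ≫ cokernel.desc a x h₁ = x := cokernel.π_desc _ _ _
    have h₄ : (p ≫ e.hom) ≫ cokernel.desc a x h₁ = 0 := by
      rw [← hb, Category.assoc, h₃, h₂]
    rw [← h₃, zero_of_epi_comp _ h₄, comp_zero]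

end AbelianRecollement

/-! ### Long exact sequences of a distinguished triangle -/

section Triangle

variable {C : Type u₁} [Category.{v₁} C] [Preadditive C] [HasZeroObject C] [HasShift C ℤ]
  [∀ n : ℤ, (shiftFunctor C n).Additive] [Pretriangulated C]
  {X Y Z : C} {f : X ⟶ Y} {g : Y ⟶ Z} {h : Z ⟶ X⟦(1 : ℤ)⟧}

lemma exists_lift_snd (hT : Triangle.mk f g h ∈ distTriang C) {W : C} (x : W ⟶ Z)
    (hx : x ≫ h = 0) : ∃ y : W ⟶ Y, x = y ≫ g :=
  Triangle.coyoneda_exact₃ _ hT x hx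

lemma exists_lift_shift_fst (hT : Triangle.mk f g h ∈ distTriang C) {W : C}
    (x : W ⟶ Y⟦(1 : ℤ)⟧) (hx : x ≫ g⟦(1 : ℤ)⟧' = 0) :
    ∃ y : W ⟶ X⟦(1 : ℤ)⟧, x = y ≫ f⟦(1 : ℤ)⟧' := by
  -- Rotating three times shifts the triangle and changes the sign of each map.
  obtain ⟨y, hy⟩ : ∃ y : W ⟶ X⟦(1 : ℤ)⟧, x = y ≫ (-f⟦(1 : ℤ)⟧') :=
    Triangle.coyoneda_exact₂ _
      (rot_of_distTriang _ (rot_of_distTriang _ (rot_of_distTriang _ hT))) x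
      ((Preadditive.comp_neg x (g⟦(1 : ℤ)⟧')).trans (by rw [hx]; exact neg_zero))
  exact ⟨-y, by rw [hy, Preadditive.comp_neg, Preadditive.neg_comp]⟩

lemma exists_lift_shift_snd (hT : Triangle.mk f g h ∈ distTriang C) {W : C}
    (x : W ⟶ Z⟦(1 : ℤ)⟧) (hx : x ≫ h⟦(1 : ℤ)⟧' = 0) :
    ∃ y : W ⟶ Y⟦(1 : ℤ)⟧, x = y ≫ g⟦(1 : ℤ)⟧' :=
  exists_lift_shift_fst (rot_of_distTriang _ hT) x hx

lemma exists_desc_snd (hT : Triangle.mk f g h ∈ distTriang C) {W : C} (x : Y ⟶ W)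
    (hx : f ≫ x = 0) : ∃ y : Z ⟶ W, x = g ≫ y :=
  Triangle.yoneda_exact₂ _ hT x hx

lemma comp_eq_zero₂₃ (hT : Triangle.mk f g h ∈ distTriang C) : g ≫ h = 0 :=
  comp_distTriang_mor_zero₂₃ _ hT

lemma comp_eq_zero₃₁ (hT : Triangle.mk f g h ∈ distTriang C) : h ≫ f⟦(1 : ℤ)⟧' = 0 :=
  comp_distTriang_mor_zero₃₁ _ hT

/-- Replacing the first object of a distinguished triangle by an isomorphic one. -/
lemma distinguished_of_iso_fst (hT : Triangle.mk f g h ∈ distTriang C) {X' : C} (e : X' ≅ X) :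
    Triangle.mk (e.hom ≫ f) g (h ≫ e.inv⟦(1 : ℤ)⟧') ∈ distTriang C := by
  refine isomorphic_distinguished _ hT _ (Triangle.isoMk _ _ e (Iso.refl Y) (Iso.refl Z) ?_ ?_ ?_)
  · exact Category.comp_id (e.hom ≫ f)
  · exact (Category.comp_id g).trans (Category.id_comp g).symm
  · change (h ≫ e.inv⟦(1 : ℤ)⟧') ≫ e.hom⟦(1 : ℤ)⟧' = 𝟙 Z ≫ h
    rw [Category.assoc, ← Functor.map_comp, e.inv_hom_id, CategoryTheory.Functor.map_id, Category.comp_id,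
      Category.id_comp]

end Triangle

/-! ### The heart as an abelian category and its first extension groups -/

namespace Heart

open scoped ZeroObject

variable {C : Type u₁} [Category.{v₁} C] [Preadditive C] [HasZeroObject C] [HasShift C ℤ]
  [∀ n : ℤ, (shiftFunctor C n).Additive] [Pretriangulated C] (t : TStructure C)

lemma prop_of_triangle {T : Triangle C} (hT : T ∈ distTriang C) (h₁ : t.heart T.obj₁)
    (h₃ : t.heart T.obj₃) : t.heart T.obj₂ := by
  rw [t.mem_heart_iff] at *
  exact ⟨t.isLE₂ T hT 0 h₁.1 h₃.1, t.isGE₂ T hT 0 h₁.2 h₃.2⟩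

lemma isLE (X : t.heart.FullSubcategory) : t.IsLE X.obj 0 := ((t.mem_heart_iff _).1 X.property).1

lemma isGE (X : t.heart.FullSubcategory) : t.IsGE X.obj 0 := ((t.mem_heart_iff _).1 X.property).2

instance : HasFiniteProducts t.heart.FullSubcategory := by
  have hb (X Y : t.heart.FullSubcategory) : HasLimit (pair X Y) := by
    have hXY : t.heart (X.obj ⊞ Y.obj) :=
      prop_of_triangle t (binaryBiproductTriangle_distinguished X.obj Y.obj) X.property Y.property
    exact ⟨⟨⟨BinaryFan.mk (P := ⟨_, hXY⟩) (t.heart.homMk biprod.fst) (t.heart.homMk biprod.snd),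
      BinaryFan.IsLimit.mk _ (fun f g ↦ t.heart.homMk (biprod.lift f.hom g.hom))
        (fun f g ↦ by ext; exact biprod.lift_fst _ _) (fun f g ↦ by ext; exact biprod.lift_snd _ _)
        (fun f g m h₁ h₂ ↦ by
          ext
          refine biprod.hom_ext _ _ ?_ ?_
          · exact (congrArg InducedCategory.Hom.hom h₁).trans (biprod.lift_fst f.hom g.hom).symm
          · exact (congrArg InducedCategory.Hom.hom h₂).trans (biprod.lift_snd f.hom g.hom).symm)⟩⟩⟩
  have : HasBinaryProducts t.heart.FullSubcategory := hasBinaryProducts_of_hasLimit_pair _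
  have h₀ : t.heart (0 : C) := (t.mem_heart_iff _).2 ⟨inferInstance, inferInstance⟩
  have : HasZeroObject t.heart.FullSubcategory := ⟨⟨⟨0, h₀⟩, by
    rw [IsZero.iff_id_eq_zero]
    ext⟩⟩
  have : HasTerminal t.heart.FullSubcategory := HasZeroObject.hasTerminal
  exact hasFiniteProducts_of_has_binary_and_terminal

lemma eq_zero_of_neg ⦃X Y : t.heart.FullSubcategory⦄ ⦃n : ℤ⦄
    (f : t.heart.ι.obj X ⟶ (t.heart.ι.obj Y)⟦n⟧) (hn : n < 0) : f = 0 := by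
  have := isLE t X
  have := isGE t Y
  have : t.IsGE (Y.obj⟦n⟧) (-n) := t.isGE_shift _ 0 n (-n)
  exact t.zero_of_isLE_of_isGE f 0 (-n) (by lia) (isLE t X) this

/-- The cone of a morphism of the heart is concentrated in degrees `-1` and `0`. Truncation splits
it into the shifted kernel `A` and the cokernel `B`. -/
lemma admissible : AbelianSubcategory.admissibleMorphism t.heart.ι = ⊤ := by
  ext X₁ X₂ f
  simp only [MorphismProperty.top_apply, iff_true]
  intro X₃ f₂ f₃ hT
  have := isLE t X₁
  have := isGE t X₁
  have := isLE t X₂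
  have := isGE t X₂
  have h₁ : t.IsLE (X₁.obj⟦(1 : ℤ)⟧) 0 := by
    have := t.isLE_shift X₁.obj 0 1 (-1)
    exact t.isLE_of_le _ (-1) 0
  have h₂ : t.IsGE (X₁.obj⟦(1 : ℤ)⟧) (-1) := t.isGE_shift X₁.obj 0 1 (-1)
  have h₃ : t.IsGE X₂.obj (-1) := t.isGE_of_ge _ (-1) 0
  have hT' := rot_of_distTriang _ hT
  have hle : t.IsLE X₃ 0 := t.isLE₂ _ hT' 0 (isLE t X₂) h₁
  have hge : t.IsGE X₃ (-1) := t.isGE₂ _ hT' (-1) h₃ h₂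
  obtain ⟨A, B, hA, hB, α, β, γ, hABC⟩ := t.exists_triangle X₃ (-1) 0 (by lia)
  have hA : t.IsLE A (-1) := ⟨hA⟩
  have hB : t.IsGE B 0 := ⟨hB⟩
  have hB' : t.IsLE B 0 := by
    have : t.IsLE (A⟦(1 : ℤ)⟧) 0 := by
      have := t.isLE_shift A (-1) 1 (-2)
      exact t.isLE_of_le _ (-2) 0
    exact t.isLE₂ _ (rot_of_distTriang _ hABC) 0 hle this
  have hA' : t.IsGE A (-1) := by
    have : t.IsGE (B⟦(-1 : ℤ)⟧) (-1) := by
      have := t.isGE_shift B 0 (-1) 1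
      exact t.isGE_of_ge _ (-1) 1
    exact t.isGE₂ _ (inv_rot_of_distTriang _ hABC) (-1) this hge
  have hK : t.heart (A⟦(-1 : ℤ)⟧) :=
    (t.mem_heart_iff _).2 ⟨t.isLE_shift A (-1) (-1) 0, t.isGE_shift A (-1) (-1) 0⟩
  let e : A⟦(-1 : ℤ)⟧⟦(1 : ℤ)⟧ ≅ A := (shiftEquiv C (1 : ℤ)).counitIso.app A
  refine ⟨⟨_, hK⟩, ⟨B, (t.mem_heart_iff _).2 ⟨hB', hB⟩⟩, e.hom ≫ α, β, γ ≫ e.inv⟦(1 : ℤ)⟧', ?_⟩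
  exact distinguished_of_iso_fst hABC e

noncomputable instance [IsTriangulated C] : Abelian t.heart.FullSubcategory :=
  AbelianSubcategory.abelian t.heart.ι (eq_zero_of_neg t) (admissible t)

variable {t}

lemma comp_eq_zero {X₁ X₂ X₃ : t.heart.FullSubcategory} {f : X₁ ⟶ X₂} {g : X₂ ⟶ X₃}
    {δ : X₃.obj ⟶ X₁.obj⟦(1 : ℤ)⟧} (hT : Triangle.mk f.hom g.hom δ ∈ distTriang C) :
    f ≫ g = 0 := by
  ext
  exact comp_distTriang_mor_zero₁₂ _ hT

section

variable [IsTriangulated C]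

lemma shortExact {X₁ X₂ X₃ : t.heart.FullSubcategory} {f : X₁ ⟶ X₂} {g : X₂ ⟶ X₃}
    {δ : X₃.obj ⟶ X₁.obj⟦(1 : ℤ)⟧} (hT : Triangle.mk f.hom g.hom δ ∈ distTriang C) :
    (ShortComplex.mk f g (comp_eq_zero hT)).ShortExact := by
  let h₁ := AbelianSubcategory.isLimitKernelForkOfDistTriang (eq_zero_of_neg t) f g δ hT
  let h₂ := AbelianSubcategory.isColimitCokernelCoforkOfDistTriang (eq_zero_of_neg t) f g δ hT
  exact { exact := ShortComplex.exact_of_f_is_kernel _ h₁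
          mono_f := mono_of_isLimit_fork h₁
          epi_g := epi_of_isColimit_cofork h₂ }

omit [IsTriangulated C] in
lemma exists_triangle_of_epi {X₂ X₃ : t.heart.FullSubcategory} (g : X₂ ⟶ X₃) [Epi g] :
    ∃ (X₁ : t.heart.FullSubcategory) (f : X₁ ⟶ X₂) (δ : X₃.obj ⟶ X₁.obj⟦(1 : ℤ)⟧),
      Triangle.mk f.hom g.hom δ ∈ distTriang C :=
  AbelianSubcategory.exists_distinguished_triangle_of_epi (eq_zero_of_neg t) (admissible t) g

end

/-- An element of the first extension group is realized by an extension in the heart. -/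
lemma exists_extension {X Y : t.heart.FullSubcategory} (θ : X.obj ⟶ Y.obj⟦(1 : ℤ)⟧) :
    ∃ (E : t.heart.FullSubcategory) (f : Y ⟶ E) (g : E ⟶ X),
      Triangle.mk f.hom g.hom θ ∈ distTriang C := by
  obtain ⟨E, f, g, hT⟩ := distinguished_cocone_triangle₂ θ
  exact ⟨⟨E, prop_of_triangle t hT Y.property X.property⟩, t.heart.homMk f, t.heart.homMk g, hT⟩

section

variable [IsTriangulated C]

lemma ext_eq_zero_of_projective (P : t.heart.FullSubcategory) [Projective P]
    {K : t.heart.FullSubcategory} (θ : P.obj ⟶ K.obj⟦(1 : ℤ)⟧) : θ = 0 := by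
  obtain ⟨E, f, g, hT⟩ := exists_extension θ
  have : Epi g := (shortExact hT).epi_g
  have h₁ : (Projective.factorThru (𝟙 P) g).hom ≫ g.hom = 𝟙 _ :=
    congrArg InducedCategory.Hom.hom (Projective.factorThru_comp (𝟙 P) g)
  have h₂ : g.hom ≫ θ = 0 := comp_eq_zero₂₃ hT
  rw [← Category.id_comp θ, ← h₁, Category.assoc, h₂, comp_zero]

omit [IsTriangulated C] in
lemma projective_of_ext_eq_zero (P : t.heart.FullSubcategory)
    (h : ∀ (K : t.heart.FullSubcategory) (θ : P.obj ⟶ K.obj⟦(1 : ℤ)⟧), θ = 0) :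
    Projective P where
  factors {Y Z} f e _ := by
    obtain ⟨K, i, δ, hT⟩ := exists_triangle_of_epi e
    obtain ⟨l, hl⟩ := exists_lift_snd hT f.hom (h _ _)
    exact ⟨t.heart.homMk l, by ext; exact hl.symm⟩

/-- Vanishing of `Hom(P, -[1])` passes to extensions by the long exact sequence, so simple objects
suffice to test projectivity. -/
lemma projective_of_ext_simple_eq_zero
    (hl : ∀ K : t.heart.FullSubcategory, HasFiniteLength K) (P : t.heart.FullSubcategory)
    (h : ∀ (K : t.heart.FullSubcategory) (_ : Simple K) (θ : P.obj ⟶ K.obj⟦(1 : ℤ)⟧), θ = 0) :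
    Projective P := by
  refine projective_of_ext_eq_zero P fun K ↦ ?_
  refine HasFiniteLength.induction
    (P := fun K : t.heart.FullSubcategory ↦ ∀ θ : P.obj ⟶ K.obj⟦(1 : ℤ)⟧, θ = 0) ?_ h ?_ (hl K)
  · intro K hK θ
    exact ((shiftFunctor C (1 : ℤ)).map_isZero (t.heart.ι.map_isZero hK)).eq_of_tgt _ _
  · intro S hS h₁ h₃ θ
    have := hS.epi_g
    obtain ⟨K, i, δ, hT⟩ := exists_triangle_of_epi S.g
    have := hS.mono_f
    let l := hS.exact.lift i (comp_eq_zero hT)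
    have hl : l.hom ≫ S.f.hom = i.hom := congrArg InducedCategory.Hom.hom (hS.exact.lift_f i _)
    obtain ⟨θ', hθ'⟩ := exists_lift_shift_fst hT θ (h₃ _)
    have h₄ : θ' ≫ l.hom⟦(1 : ℤ)⟧' = 0 := h₁ _
    rw [hθ', ← hl, Functor.map_comp, reassoc_of% h₄, zero_comp]

end

end Heart

/-! ### Projective objects from minimal lifts of universal extensions -/

namespace Heart

variable {C : Type u₁} [Category.{v₁} C] [Preadditive C] [HasZeroObject C] [HasShift C ℤ]
  [∀ n : ℤ, (shiftFunctor C n).Additive] [Pretriangulated C] [IsTriangulated C]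
  {t : TStructure C}

/-- If `N` is a quotient of a projective object `Q` by a subobject which is minimal among those to
which the class of an extension of `T` lifts, and if this class generates all the extensions of `T`
by simple objects, then the resulting extension is projective. -/
lemma projective_of_minimal (hl : ∀ K : t.heart.FullSubcategory, HasFiniteLength K)
    {T N P Q : t.heart.FullSubcategory} [Projective Q] (q : Q ⟶ N) [Epi q]
    {ξ : T.obj ⟶ N.obj⟦(1 : ℤ)⟧} {i : N ⟶ P} {p : P ⟶ T}
    (hT : Triangle.mk i.hom p.hom ξ ∈ distTriang C)
    (hgen : ∀ (K : t.heart.FullSubcategory) (_ : Simple K) (η : T.obj ⟶ K.obj⟦(1 : ℤ)⟧),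
      ∃ f : N ⟶ K, η = ξ ≫ f.hom⟦(1 : ℤ)⟧')
    (hmin : ∀ (N' : t.heart.FullSubcategory) (q' : Q ⟶ N') (_ : Epi q') (r : N' ⟶ N)
      (_ : q' ≫ r = q) (ξ' : T.obj ⟶ N'.obj⟦(1 : ℤ)⟧) (_ : ξ' ≫ r.hom⟦(1 : ℤ)⟧' = ξ), Mono r) :
    Projective P := by
  refine projective_of_ext_simple_eq_zero hl P fun K hK θ ↦ ?_
  -- A class vanishing on `N` comes from `T`, hence is a pushout of `ξ`, and `ξ` becomes zero on
  -- `P`.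
  suffices hθ : i.hom ≫ θ = 0 by
    obtain ⟨η, rfl⟩ := exists_desc_snd hT θ hθ
    obtain ⟨f, rfl⟩ := hgen K hK η
    rw [← Category.assoc, comp_eq_zero₂₃ hT, zero_comp]
  obtain ⟨N', k, r, hT'⟩ := exists_extension (i.hom ≫ θ)
  have hS := shortExact hT'
  have hkr : k ≫ r = 0 := comp_eq_zero hT'
  have : Mono k := hS.mono_f
  have : Epi r := hS.epi_g
  let q' : Q ⟶ N' := Projective.factorThru q r
  have hq' : q' ≫ r = q := Projective.factorThru_comp q r
  -- The obstruction to lifting `ξ` to `N'` is its composite with the shift of `i ≫ θ`, which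
  -- contains two consecutive maps of the triangle `hT`.
  obtain ⟨ξ', hξ'⟩ := exists_lift_shift_snd hT' ξ (by
    rw [Functor.map_comp, ← Category.assoc, comp_eq_zero₃₁ hT, zero_comp])
  have hk : k ≠ 0 := fun h ↦ Simple.not_isZero K (by
    rw [IsZero.iff_id_eq_zero, ← cancel_mono k, h, comp_zero, comp_zero])
  -- Otherwise `q'` is epi, so `N'` competes with `N` and minimality makes `r` mono, although its
  -- kernel `K` is nonzero.
  have hc : k ≫ cokernel.π q' ≠ 0 := fun h ↦ by
    have h₁ : r ≫ hS.exact.desc (cokernel.π q') h = cokernel.π q' := hS.exact.g_desc _ h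
    have h₂ : hS.exact.desc (cokernel.π q') h = 0 := by
      rw [← cancel_epi q, ← hq', Category.assoc, h₁, cokernel.condition, comp_zero]
    rw [h₂, comp_zero] at h₁
    have : Epi q' := Preadditive.epi_of_cokernel_zero h₁.symm
    have := hmin N' q' inferInstance r hq' ξ' hξ'.symm
    exact hk (by rw [← cancel_mono r, hkr, zero_comp])
  have h₁ : Epi (k ≫ cokernel.π q') := by
    refine Preadditive.epi_of_cancel_zero _ fun {B} x hx ↦ ?_
    rw [Category.assoc] at hx
    have h₁ : r ≫ hS.exact.desc _ hx = cokernel.π q' ≫ x := hS.exact.g_desc _ hx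
    have h₂ : hS.exact.desc _ hx = 0 := by
      rw [← cancel_epi q, ← hq', Category.assoc, h₁, cokernel.condition_assoc, zero_comp, comp_zero]
    rw [h₂, comp_zero] at h₁
    rw [← cancel_epi (cokernel.π q'), ← h₁, comp_zero]
  have : IsIso (k ≫ cokernel.π q') := isIso_of_epi_of_nonzero hc
  -- The cokernel of `q'` is thus a copy of `K`, which gives a retraction of `k`: the extension
  -- splits and its class `i ≫ θ` is zero.
  have h₂ : k.hom ≫ (cokernel.π q' ≫ inv (k ≫ cokernel.π q')).hom = 𝟙 K.obj := by
    have : k ≫ cokernel.π q' ≫ inv (k ≫ cokernel.π q') = 𝟙 K := by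
      rw [← Category.assoc, IsIso.hom_inv_id]
    exact congrArg InducedCategory.Hom.hom this
  rw [← Category.comp_id (i.hom ≫ θ), ← CategoryTheory.Functor.map_id, ← h₂, Functor.map_comp,
    ← Category.assoc, comp_eq_zero₃₁ hT', zero_comp]

/-- Let `E` be a quotient of a projective object, and suppose that a class in `Ext¹(T, E)`
generates all the extensions of `T` by simple objects. Then `T` is a quotient of a projective
object. -/
theorem exists_projective_of_universal
    (hl : ∀ K : t.heart.FullSubcategory, HasFiniteLength K)
    {T E Q : t.heart.FullSubcategory} [Projective Q] (π : Q ⟶ E) [Epi π]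
    (ξ : T.obj ⟶ E.obj⟦(1 : ℤ)⟧)
    (hgen : ∀ (K : t.heart.FullSubcategory) (_ : Simple K) (η : T.obj ⟶ K.obj⟦(1 : ℤ)⟧),
      ∃ f : E ⟶ K, η = ξ ≫ f.hom⟦(1 : ℤ)⟧') :
    ∃ (P : t.heart.FullSubcategory) (_ : Projective P) (p : P ⟶ T), Epi p := by
  have := (hl Q).2
  -- Minimize the kernel of `Q ⟶ N` over the quotients `N` of `Q` lying over `E` to which `ξ` lifts;
  -- `E` itself is one.
  obtain ⟨_, ⟨N, q, hq, g, hg, ξ₀, hξ₀, rfl⟩, hmin⟩ := (wellFounded_lt (α := Subobject Q)).has_min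
    {M | ∃ (N : t.heart.FullSubcategory) (q : Q ⟶ N) (_ : Epi q) (g : N ⟶ E) (_ : q ≫ g = π)
      (ξ₀ : T.obj ⟶ N.obj⟦(1 : ℤ)⟧) (_ : ξ₀ ≫ g.hom⟦(1 : ℤ)⟧' = ξ), M = kernelSubobject q}
    ⟨_, E, π, inferInstance, 𝟙 E, Category.comp_id π, ξ,
      (congrArg (ξ ≫ ·) ((shiftFunctor C (1 : ℤ)).map_id E.obj)).trans (Category.comp_id ξ), rfl⟩
  obtain ⟨P, i, p, hT⟩ := exists_extension ξ₀
  refine ⟨P, projective_of_minimal hl q hT ?_ ?_, p, (shortExact hT).epi_g⟩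
  · intro K hK η
    obtain ⟨f, rfl⟩ := hgen K hK η
    refine ⟨g ≫ f, ?_⟩
    rw [← hξ₀, Category.assoc, ← Functor.map_comp]
    rfl
  · intro N' q' hq' r hr ξ' hξ'
    -- By minimality both quotients of `Q` have the same kernel, so the map `r` between them is
    -- mono.
    have hle : kernelSubobject q' ≤ kernelSubobject q := by
      refine le_kernelSubobject q _ ?_
      rw [← hr, kernelSubobject_arrow_comp_assoc, zero_comp]
    have hle' : kernelSubobject q ≤ kernelSubobject q' := by
      by_contra h
      refine hmin (kernelSubobject q') ⟨N', q', hq', r ≫ g, by rw [← Category.assoc, hr, hg],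
        ξ', ?_, rfl⟩ (lt_of_le_not_ge hle h)
      rw [← hξ₀, ← hξ', Category.assoc, ← Functor.map_comp]
      rfl
    refine Preadditive.mono_of_cancel_zero _ fun {B} x hx ↦ ?_
    obtain ⟨B', π', hπ', y, hy⟩ := surjective_up_to_refinements_of_epi q' x
    have h₁ : (kernelSubobject q).Factors y :=
      kernelSubobject_factors _ _ (by
        rw [← hr, ← Category.assoc, ← hy, Category.assoc, hx, comp_zero])
    have h₂ := Subobject.factors_of_le y hle' h₁
    rw [← cancel_epi π', hy, (kernelSubobject_factors_iff _ _).1 h₂, comp_zero]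

end Heart

/-! ### Functors and adjunctions induced on hearts -/

namespace Heart

variable {C : Type u₁} [Category.{v₁} C] [Preadditive C] [HasZeroObject C] [HasShift C ℤ]
  [∀ n : ℤ, (shiftFunctor C n).Additive] [Pretriangulated C] [IsTriangulated C]
  {D : Type u₂} [Category.{v₂} D] [Preadditive D] [HasZeroObject D] [HasShift D ℤ]
  [∀ n : ℤ, (shiftFunctor D n).Additive] [Pretriangulated D] [IsTriangulated D]
  {t : TStructure C} {t' : TStructure D}

section

variable (t)

instance (X : t.heart.FullSubcategory) : t.IsLE X.obj 0 := isLE t X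

instance (X : t.heart.FullSubcategory) : t.IsLE X.obj (1 - 1) := isLE t X

instance (X : t.heart.FullSubcategory) : t.IsGE X.obj 0 := isGE t X

instance (X : t.heart.FullSubcategory) : t.IsLE (t.heart.ι.obj X) 0 := isLE t X

instance (X : t.heart.FullSubcategory) : t.IsGE (t.heart.ι.obj X) 0 := isGE t X

omit [IsTriangulated C] in
lemma triangle_truncLT_truncGE (n : ℤ) (X : C) :
    Triangle.mk ((t.truncLTι n).app X) ((t.truncGEπ n).app X) ((t.truncGEδLT n).app X) ∈
      distTriang C :=
  t.triangleLTGE_distinguished n X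

lemma heart_truncGE (X : C) (hX : t.IsLE X 0) : t.heart ((t.truncGE 0).obj X) := by
  exact (t.mem_heart_iff _).2 ⟨inferInstance, inferInstance⟩

lemma heart_truncLT (X : C) (hX : t.IsGE X 0) : t.heart ((t.truncLT 1).obj X) := by
  exact (t.mem_heart_iff _).2 ⟨t.isLE_truncLT_obj X 1 0, inferInstance⟩

end

/-- The functor induced on the hearts by a functor which preserves them. -/
def functor (t : TStructure C) (t' : TStructure D) (F : C ⥤ D)
    (hF : ∀ X, t.heart X → t'.heart (F.obj X)) :
    t.heart.FullSubcategory ⥤ t'.heart.FullSubcategory :=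
  t'.heart.lift (t.heart.ι ⋙ F) fun X ↦ hF _ X.property

instance (F : C ⥤ D) (hF : ∀ X, t.heart X → t'.heart (F.obj X)) [F.Additive] :
    (functor t t' F hF).Additive where
  map_add {X Y f g} := by
    ext
    exact F.map_add

instance (F : C ⥤ D) (hF : ∀ X, t.heart X → t'.heart (F.obj X)) [F.Full] :
    (functor t t' F hF).Full :=
  inferInstanceAs (t'.heart.lift (t.heart.ι ⋙ F) fun X ↦ hF _ X.property).Full

instance (F : C ⥤ D) (hF : ∀ X, t.heart X → t'.heart (F.obj X)) [F.Faithful] :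
    (functor t t' F hF).Faithful :=
  inferInstanceAs (t'.heart.lift (t.heart.ι ⋙ F) fun X ↦ hF _ X.property).Faithful

/-- The functor induced on the hearts by a functor `L` which sends the heart to nonpositive
objects: it sends `X` to the zeroth cohomology of `L X`. -/
noncomputable def leftFunctor (t : TStructure C) (t' : TStructure D) (L : C ⥤ D)
    (hL : ∀ X, t.heart X → t'.IsLE (L.obj X) 0) :
    t.heart.FullSubcategory ⥤ t'.heart.FullSubcategory :=
  t'.heart.lift (t.heart.ι ⋙ L ⋙ t'.truncGE 0) fun X ↦ heart_truncGE t' _ (hL _ X.property)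

/-- The functor induced on the hearts by a functor `G` which sends the heart to nonnegative
objects: it sends `X` to the zeroth cohomology of `G X`. -/
noncomputable def rightFunctor (t : TStructure C) (t' : TStructure D) (G : C ⥤ D)
    (hG : ∀ X, t.heart X → t'.IsGE (G.obj X) 0) :
    t.heart.FullSubcategory ⥤ t'.heart.FullSubcategory :=
  t'.heart.lift (t.heart.ι ⋙ G ⋙ t'.truncLT 1) fun X ↦ heart_truncLT t' _ (hG _ X.property)

/-- The left adjoint of a functor induced on the hearts. -/
noncomputable def leftAdjunction {L : C ⥤ D} {F : D ⥤ C} (adj : L ⊣ F)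
    (hL : ∀ X, t.heart X → t'.IsLE (L.obj X) 0) (hF : ∀ Y, t'.heart Y → t.heart (F.obj Y)) :
    leftFunctor t t' L hL ⊣ functor t' t F hF :=
  Adjunction.mkOfHomEquiv
    { homEquiv X Y :=
        { toFun f := t.heart.homMk
            (adj.homEquiv X.obj Y.obj ((t'.truncGEπ 0).app (L.obj X.obj) ≫ f.hom))
          invFun g := t'.heart.homMk (t'.descTruncGE ((adj.homEquiv X.obj Y.obj).symm g.hom) 0)
          left_inv f := by
            ext
            refine t'.from_truncGE_obj_ext ?_
            refine (t'.π_descTruncGE _ 0).trans ?_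
            exact Equiv.symm_apply_apply _ _
          right_inv g := by
            ext
            refine Eq.trans (congrArg (adj.homEquiv _ _) (t'.π_descTruncGE _ 0)) ?_
            exact Equiv.apply_symm_apply _ _ }
      homEquiv_naturality_left_symm {X' X Y} f g := by
        ext
        refine t'.from_truncGE_obj_ext ?_
        refine (t'.π_descTruncGE _ 0).trans ?_
        refine (adj.homEquiv_naturality_left_symm f.hom g.hom).trans ?_
        have h := (t'.truncGEπ 0).naturality (L.map f.hom)
        refine Eq.trans ?_ (Category.assoc _ _ _)
        refine Eq.trans ?_ (congrArg (· ≫ _) h)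
        refine Eq.trans ?_ (Category.assoc _ _ _).symm
        exact congrArg (L.map f.hom ≫ ·) (t'.π_descTruncGE _ 0).symm
      homEquiv_naturality_right {X Y Y'} f g := by
        ext
        refine Eq.trans ?_ (adj.homEquiv_naturality_right _ _)
        exact congrArg (adj.homEquiv _ _) (Category.assoc _ _ _).symm }

omit [IsTriangulated C] in
lemma leftAdjunction_unit_app_hom {L : C ⥤ D} {F : D ⥤ C} (adj : L ⊣ F)
    (hL : ∀ X, t.heart X → t'.IsLE (L.obj X) 0) (hF : ∀ Y, t'.heart Y → t.heart (F.obj Y))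
    (X : t.heart.FullSubcategory) :
    ((leftAdjunction adj hL hF).unit.app X).hom =
      adj.unit.app X.obj ≫ F.map ((t'.truncGEπ 0).app (L.obj X.obj)) := by
  refine Eq.trans ?_ (adj.homEquiv_unit _ _ _)
  have h := (leftAdjunction adj hL hF).homEquiv_id X
  rw [← h]
  rw [leftAdjunction, Adjunction.mkOfHomEquiv_homEquiv]
  exact congrArg (adj.homEquiv X.obj _) (Category.comp_id ((t'.truncGEπ 0).app (L.obj X.obj)))

/-- The right adjoint of a functor induced on the hearts. -/
noncomputable def rightAdjunction {F : C ⥤ D} {G : D ⥤ C} (adj : F ⊣ G)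
    (hF : ∀ X, t.heart X → t'.heart (F.obj X)) (hG : ∀ Y, t'.heart Y → t.IsGE (G.obj Y) 0) :
    functor t t' F hF ⊣ rightFunctor t' t G hG :=
  Adjunction.mkOfHomEquiv
    { homEquiv X Y :=
        { toFun f := t.heart.homMk (t.liftTruncLT (adj.homEquiv X.obj Y.obj f.hom) 0 1 (zero_add 1))
          invFun g := t'.heart.homMk
            ((adj.homEquiv X.obj Y.obj).symm (g.hom ≫ (t.truncLTι 1).app (G.obj Y.obj)))
          left_inv f := by
            ext
            refine Eq.trans (congrArg (adj.homEquiv _ _).symm (t.liftTruncLT_ι _ 0 1 (zero_add 1))) ?_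
            exact Equiv.symm_apply_apply _ _
          right_inv g := by
            ext
            refine t.to_truncLT_obj_ext (n := 1) ?_
            refine (t.liftTruncLT_ι _ 0 1 (zero_add 1)).trans ?_
            exact Equiv.apply_symm_apply _ _ }
      homEquiv_naturality_left_symm {X' X Y} f g := by
        ext
        refine Eq.trans ?_ (adj.homEquiv_naturality_left_symm _ _)
        exact congrArg (adj.homEquiv _ _).symm (Category.assoc _ _ _)
      homEquiv_naturality_right {X Y Y'} f g := by
        ext
        refine t.to_truncLT_obj_ext (n := 1) ?_
        refine (t.liftTruncLT_ι _ 0 1 (zero_add 1)).trans ?_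
        refine (adj.homEquiv_naturality_right f.hom g.hom).trans ?_
        have h := (t.truncLTι 1).naturality (G.map g.hom)
        refine Eq.trans ?_ (Category.assoc _ _ _).symm
        refine Eq.trans ?_ (congrArg (_ ≫ ·) h.symm)
        refine Eq.trans ?_ (Category.assoc _ _ _)
        exact congrArg (· ≫ G.map g.hom) (t.liftTruncLT_ι _ 0 1 (zero_add 1)).symm }

end Heart

/-! ### The recollement of the hearts of glued t-structures -/

namespace Recollement

variable {k : Type w} [Field k]
  {DZ : Type u₁} [Category.{v₁} DZ] [Preadditive DZ] [HasZeroObject DZ] [HasShift DZ ℤ]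
  [∀ n : ℤ, (shiftFunctor DZ n).Additive] [Pretriangulated DZ] [Linear k DZ]
  {DX : Type u₂} [Category.{v₂} DX] [Preadditive DX] [HasZeroObject DX] [HasShift DX ℤ]
  [∀ n : ℤ, (shiftFunctor DX n).Additive] [Pretriangulated DX] [Linear k DX]
  {DU : Type u₃} [Category.{v₃} DU] [Preadditive DU] [HasZeroObject DU] [HasShift DU ℤ]
  [∀ n : ℤ, (shiftFunctor DU n).Additive] [Pretriangulated DU] [Linear k DU]
  (R : Recollement k DZ DX DU) (tZ : TStructure DZ) (tU : TStructure DU)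

lemma isZero_iPull_jShriek (V : DU) : IsZero (R.iPull.obj (R.jShriek.obj V)) := by
  rw [IsZero.iff_id_eq_zero]
  apply (R.iPullAdj.homEquiv _ _).injective
  apply (R.jShriekAdj.homEquiv _ _).injective
  exact (R.isZero_jPull_iStar _).eq_of_tgt _ _

lemma isIso_unit_of_isZero_jPull {K : DX} (hK : IsZero (R.jPull.obj K)) :
    IsIso (R.iPullAdj.unit.app K) := by
  obtain ⟨d, hd⟩ := R.exists_triangle_shriek K
  refine (Triangle.isZero₁_iff_isIso₂ _ hd).1 ?_
  rw [IsZero.iff_id_eq_zero]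
  exact (R.jShriekAdj.homEquiv _ _).injective ((hK.eq_of_src _ _))

variable [IsTriangulated DX]

lemma heart_jPull (K : DX) (hK : (R.gluedTStructure tZ tU).heart K) :
    tU.heart (R.jPull.obj K) :=
  ⟨hK.1.1, hK.2.1⟩

lemma heart_iStar (W : DZ) (hW : tZ.heart W) :
    (R.gluedTStructure tZ tU).heart (R.iStar.obj W) := by
  have h := R.isZero_jPull_iStar W
  exact ⟨⟨(tU.isLE_of_isZero h 0).le,
    (tZ.le 0).prop_of_iso (asIso (R.iPullAdj.counit.app W)).symm hW.1⟩,
    ⟨(tU.isGE_of_isZero h 0).ge,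
    (tZ.ge 0).prop_of_iso (asIso (R.iShriekAdj.unit.app W)) hW.2⟩⟩

lemma isLE_iPull (K : DX) (hK : (R.gluedTStructure tZ tU).heart K) :
    tZ.IsLE (R.iPull.obj K) 0 :=
  ⟨hK.1.2⟩

lemma isGE_iShriek (K : DX) (hK : (R.gluedTStructure tZ tU).heart K) :
    tZ.IsGE (R.iShriek.obj K) 0 :=
  ⟨hK.2.2⟩

lemma isLE_jShriek (V : DU) (hV : tU.heart V) :
    (R.gluedTStructure tZ tU).IsLE (R.jShriek.obj V) 0 :=
  ⟨(tU.le 0).prop_of_iso (asIso (R.jShriekAdj.unit.app V)) hV.1,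
    (tZ.isLE_of_isZero (R.isZero_iPull_jShriek V) 0).le⟩

lemma isGE_jStar (V : DU) (hV : tU.heart V) :
    (R.gluedTStructure tZ tU).IsGE (R.jStar.obj V) 0 :=
  ⟨(tU.ge 0).prop_of_iso (asIso (R.jStarAdj.counit.app V)).symm hV.2,
    (tZ.isGE_of_isZero (R.isZero_iShriek_jStar V) 0).ge⟩

/-- Restriction to `DU` is t-exact and `j^* j_! V ≅ V` lies in the heart, so the restriction of the
negative truncation of `j_! V` lies both in degrees `≤ -1` and in degrees `≥ 0`. -/
lemma isIso_jPull_map_truncGEπ (V : DU) (hV : tU.heart V) :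
    IsIso (R.jPull.map (((R.gluedTStructure tZ tU).truncGEπ 0).app (R.jShriek.obj V))) := by
  let t := R.gluedTStructure tZ tU
  have hT := R.jPull.map_distinguished _
    (Heart.triangle_truncLT_truncGE t 0 (R.jShriek.obj V))
  refine (Triangle.isZero₁_iff_isIso₂ _ hT).1 ?_
  have h₁ : tU.IsLE (R.jPull.obj ((t.truncLT 0).obj (R.jShriek.obj V))) (-1) :=
    ⟨(t.isLE_truncLT_obj (R.jShriek.obj V) 0 (-1)).le.1⟩
  have h₃ : tU.IsGE (R.jPull.obj ((t.truncGE 0).obj (R.jShriek.obj V))) 0 :=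
    ⟨(t.ge_of_isGE ((t.truncGE 0).obj (R.jShriek.obj V)) 0).1⟩
  have h₂ : tU.IsGE (R.jPull.obj (R.jShriek.obj V)) 0 :=
    ⟨(tU.ge 0).prop_of_iso (asIso (R.jShriekAdj.unit.app V)) hV.2⟩
  have h₄ := tU.isGE_shift (R.jPull.obj ((t.truncGE 0).obj (R.jShriek.obj V))) 0 (-1) 1
  have h₅ := tU.isGE₂ _ (inv_rot_of_distTriang _ hT) 0 (@TStructure.isGE_of_ge _ _ _ _ _ _ _ tU _ 0 1 (by omega) h₄) h₂
  exact @TStructure.isZero _ _ _ _ _ _ _ tU _ (-1) 0 (by omega) h₁ h₅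

variable [IsTriangulated DZ] [IsTriangulated DU]

/-- The hearts of glued t-structures form a recollement of abelian categories. -/
noncomputable def heart : AbelianRecollement tZ.heart.FullSubcategory
    (R.gluedTStructure tZ tU).heart.FullSubcategory tU.heart.FullSubcategory where
  i := Heart.functor tZ (R.gluedTStructure tZ tU) R.iStar (R.heart_iStar tZ tU)
  j := Heart.functor (R.gluedTStructure tZ tU) tU R.jPull (R.heart_jPull tZ tU)
  il := Heart.leftFunctor (R.gluedTStructure tZ tU) tZ R.iPull (R.isLE_iPull tZ tU)
  ir := Heart.rightFunctor (R.gluedTStructure tZ tU) tZ R.iShriek (R.isGE_iShriek tZ tU)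
  jl := Heart.leftFunctor tU (R.gluedTStructure tZ tU) R.jShriek (R.isLE_jShriek tZ tU)
  jr := Heart.rightFunctor tU (R.gluedTStructure tZ tU) R.jStar (R.isGE_jStar tZ tU)
  ilAdj := Heart.leftAdjunction R.iPullAdj _ _
  irAdj := Heart.rightAdjunction R.iShriekAdj _ _
  jlAdj := Heart.leftAdjunction R.jShriekAdj _ _
  jrAdj := Heart.rightAdjunction R.jStarAdj _ _
  isZero_j_i W := by
    rw [IsZero.iff_id_eq_zero]
    ext
    exact (R.isZero_jPull_iStar W.obj).eq_of_src _ _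
  exists_iso K hK := by
    have := R.isIso_unit_of_isZero_jPull (K := K.obj) (tU.heart.ι.map_isZero hK)
    let e : K.obj ≅ R.iStar.obj (R.iPull.obj K.obj) := asIso (R.iPullAdj.unit.app K.obj)
    -- Glueing bounds `i^* K` above and `i^! K` below; these objects are isomorphic since `K ≅ i_*
    -- i^* K`.
    have hW : tZ.heart (R.iPull.obj K.obj) := ⟨K.property.1.2,
      (tZ.ge 0).prop_of_iso (R.iShriek.mapIso e ≪≫
        (asIso (R.iShriekAdj.unit.app (R.iPull.obj K.obj))).symm) K.property.2.2⟩
    exact ⟨⟨R.iPull.obj K.obj, hW⟩, ⟨(R.gluedTStructure tZ tU).heart.isoMk e.symm⟩⟩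
  isIso_jlAdj_unit_app V := by
    have := R.isIso_jPull_map_truncGEπ tZ tU V.obj V.property
    have : IsIso (tU.heart.ι.map ((Heart.leftAdjunction R.jShriekAdj (R.isLE_jShriek tZ tU)
        (R.heart_jPull tZ tU)).unit.app V)) :=
      (congrArg IsIso (Heart.leftAdjunction_unit_app_hom R.jShriekAdj (R.isLE_jShriek tZ tU)
        (R.heart_jPull tZ tU) V)).mpr (IsIso.comp_isIso' inferInstance this)
    exact isIso_of_reflects_iso _ tU.heart.ι

end Recollement

/-! ### Universal extensions from finite-dimensional extension groups -/

namespace Heart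

variable {C : Type u₁} [Category.{v₁} C] [Preadditive C] [HasZeroObject C] [HasShift C ℤ]
  [∀ n : ℤ, (shiftFunctor C n).Additive] [Pretriangulated C] [IsTriangulated C]
  {t : TStructure C}

open scoped ZeroObject in
/-- Finitely many extensions of `T` by quotients of projective objects are all induced by a single
extension of `T` by a quotient of a projective object. -/
lemma exists_universal {T : t.heart.FullSubcategory}
    (l : List (Σ K : t.heart.FullSubcategory, T.obj ⟶ K.obj⟦(1 : ℤ)⟧))
    (hl : ∀ x ∈ l, ∃ (Q : t.heart.FullSubcategory) (_ : Projective Q) (q : Q ⟶ x.1), Epi q) :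
    ∃ (E Q : t.heart.FullSubcategory) (_ : Projective Q) (q : Q ⟶ E) (_ : Epi q)
      (ξ : T.obj ⟶ E.obj⟦(1 : ℤ)⟧),
      ∀ x ∈ l, ∃ f : E ⟶ x.1, x.2 = ξ ≫ f.hom⟦(1 : ℤ)⟧' := by
  induction l with
  | nil =>
    exact ⟨0, 0, inferInstance, 𝟙 _, inferInstance, 0, fun x hx ↦ (List.not_mem_nil hx).elim⟩
  | cons x l ih =>
    obtain ⟨E, Q, hQ, q, hq, ξ, hξ⟩ := ih fun y hy ↦ hl y (List.mem_cons_of_mem _ hy)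
    obtain ⟨Q', hQ', q', hq'⟩ := hl x List.mem_cons_self
    -- The class with components `ξ` and `x.2`; the projections of `E ⊞ x.1` recover both.
    let ξ' : T.obj ⟶ (E ⊞ x.1).obj⟦(1 : ℤ)⟧ :=
      ξ ≫ (biprod.inl : E ⟶ E ⊞ x.1).hom⟦(1 : ℤ)⟧' +
        x.2 ≫ (biprod.inr : x.1 ⟶ E ⊞ x.1).hom⟦(1 : ℤ)⟧'
    have key : ∀ {K : t.heart.FullSubcategory} (f : E ⊞ x.1 ⟶ K), ξ' ≫ f.hom⟦(1 : ℤ)⟧' =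
        ξ ≫ (biprod.inl ≫ f).hom⟦(1 : ℤ)⟧' + x.2 ≫ (biprod.inr ≫ f).hom⟦(1 : ℤ)⟧' := by
      intro K f
      refine (Preadditive.add_comp _ _ _ _ _ _).trans (congrArg₂ (· + ·) ?_ ?_)
      · exact (Category.assoc _ _ _).trans
          (congrArg (ξ ≫ ·) ((shiftFunctor C (1 : ℤ)).map_comp _ _).symm)
      · exact (Category.assoc _ _ _).trans
          (congrArg (x.2 ≫ ·) ((shiftFunctor C (1 : ℤ)).map_comp _ _).symm)
    have hz : ∀ (K L : t.heart.FullSubcategory),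
        (0 : K ⟶ L).hom⟦(1 : ℤ)⟧' = (0 : K.obj⟦(1 : ℤ)⟧ ⟶ L.obj⟦(1 : ℤ)⟧) :=
      fun K L ↦ (shiftFunctor C (1 : ℤ)).map_zero K.obj L.obj
    have hid : ∀ (K : t.heart.FullSubcategory),
        (𝟙 K : K ⟶ K).hom⟦(1 : ℤ)⟧' = 𝟙 (K.obj⟦(1 : ℤ)⟧) :=
      fun K ↦ (shiftFunctor C (1 : ℤ)).map_id K.obj
    refine ⟨E ⊞ x.1, Q ⊞ Q', inferInstance, biprod.map q q', inferInstance, ξ', fun y hy ↦ ?_⟩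
    rcases List.mem_cons.1 hy with rfl | hy
    · exact ⟨biprod.snd, by
        rw [key, biprod.inl_snd, biprod.inr_snd, hz, hid, comp_zero, zero_add, Category.comp_id]⟩
    · obtain ⟨f, hf⟩ := hξ y hy
      exact ⟨biprod.desc f 0, by
        rw [key, biprod.inl_desc, biprod.inr_desc, hz, comp_zero, add_zero, hf]⟩

variable {k : Type w} [Field k] [Linear k C] [∀ n : ℤ, (shiftFunctor C n).Linear k]

/-- In a Hom-finite triangulated category with a t-structure whose heart is a length category, an
object of the heart is a quotient of a projective object as soon as, up to isomorphism, only
finitely many simple objects extend it nontrivially, each a quotient of a projective object. -/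
theorem exists_projective_of_finite (hC : IsHomFinite k C)
    (hl : ∀ K : t.heart.FullSubcategory, HasFiniteLength K)
    {T : t.heart.FullSubcategory} {n : ℕ} (L : Fin n → t.heart.FullSubcategory)
    (hL : ∀ i, ∃ (Q : t.heart.FullSubcategory) (_ : Projective Q) (q : Q ⟶ L i), Epi q)
    (hT : ∀ K : t.heart.FullSubcategory, Simple K →
      (∀ η : T.obj ⟶ K.obj⟦(1 : ℤ)⟧, η = 0) ∨ ∃ i, Nonempty (K ≅ L i)) :
    ∃ (P : t.heart.FullSubcategory) (_ : Projective P) (p : P ⟶ T), Epi p := by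
  have hfin (i : Fin n) : ∃ G : Finset (T.obj ⟶ (L i).obj⟦(1 : ℤ)⟧),
      Submodule.span k (G : Set (T.obj ⟶ (L i).obj⟦(1 : ℤ)⟧)) = ⊤ :=
    (hC T.obj ((L i).obj⟦(1 : ℤ)⟧)).fg_top
  choose G hG using hfin
  obtain ⟨E, Q, hQ, q, hq, ξ, hξ⟩ := exists_universal (T := T)
    ((List.finRange n).flatMap fun i ↦ (G i).toList.map fun η ↦ ⟨L i, η⟩) (by
      intro x hx
      obtain ⟨i, -, hi⟩ := List.mem_flatMap.1 hx
      obtain ⟨η, -, rfl⟩ := List.mem_map.1 hi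
      exact hL i)
  have hgen (i : Fin n) (η : T.obj ⟶ (L i).obj⟦(1 : ℤ)⟧) :
      ∃ f : E ⟶ L i, η = ξ ≫ f.hom⟦(1 : ℤ)⟧' := by
    -- The classes induced from `ξ` form a subspace, since pushing `ξ` forward is linear in `f`, and
    -- this subspace contains the chosen generators.
    have hη : η ∈ Submodule.span k (G i : Set (T.obj ⟶ (L i).obj⟦(1 : ℤ)⟧)) := by
      rw [hG]; exact Submodule.mem_top
    induction hη using Submodule.span_induction with
    | mem η hη =>
      exact hξ ⟨L i, η⟩ (List.mem_flatMap.2 ⟨i, List.mem_finRange i,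
        List.mem_map.2 ⟨η, Finset.mem_toList.2 hη, rfl⟩⟩)
    | zero =>
      exact ⟨0, ((congrArg (ξ ≫ ·) ((shiftFunctor C (1 : ℤ)).map_zero E.obj (L i).obj)).trans
        comp_zero).symm⟩
    | add η η' _ _ h h' =>
      obtain ⟨f, rfl⟩ := h
      obtain ⟨f', rfl⟩ := h'
      exact ⟨f + f', ((congrArg (ξ ≫ ·) ((shiftFunctor C (1 : ℤ)).map_add)).trans
        (Preadditive.comp_add _ _ _ _ _ _)).symm⟩
    | smul c η _ h =>
      obtain ⟨f, rfl⟩ := h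
      exact ⟨t.heart.homMk (c • f.hom), ((congrArg (ξ ≫ ·)
        ((shiftFunctor C (1 : ℤ)).map_smul c f.hom)).trans (Linear.comp_smul _ _ _ _ _ _)).symm⟩
  refine exists_projective_of_universal hl q ξ fun K hK η ↦ ?_
  rcases hT K hK with h | ⟨i, ⟨e⟩⟩
  · exact ⟨0, (h η).trans (h _).symm⟩
  · obtain ⟨f, hf⟩ := hgen i (η ≫ e.hom.hom⟦(1 : ℤ)⟧')
    have he : e.hom.hom⟦(1 : ℤ)⟧' ≫ e.inv.hom⟦(1 : ℤ)⟧' = 𝟙 (K.obj⟦(1 : ℤ)⟧) :=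
      ((shiftFunctor C (1 : ℤ)).map_comp _ _).symm.trans
        ((congrArg (fun f : K ⟶ K ↦ f.hom⟦(1 : ℤ)⟧') e.hom_inv_id).trans
          ((shiftFunctor C (1 : ℤ)).map_id K.obj))
    refine ⟨f ≫ e.inv, ?_⟩
    have h₁ : (f ≫ e.inv).hom⟦(1 : ℤ)⟧' = f.hom⟦(1 : ℤ)⟧' ≫ e.inv.hom⟦(1 : ℤ)⟧' :=
      (shiftFunctor C (1 : ℤ)).map_comp _ _
    rw [h₁, ← Category.assoc, ← hf, Category.assoc, he, Category.comp_id]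

end Heart

/-! ### Enough projectives in the glued heart -/

namespace Recollement

variable {k : Type w} [Field k]
  {DZ : Type u₁} [Category.{v₁} DZ] [Preadditive DZ] [HasZeroObject DZ] [HasShift DZ ℤ]
  [∀ n : ℤ, (shiftFunctor DZ n).Additive] [Pretriangulated DZ] [IsTriangulated DZ] [Linear k DZ]
  {DX : Type u₂} [Category.{v₂} DX] [Preadditive DX] [HasZeroObject DX] [HasShift DX ℤ]
  [∀ n : ℤ, (shiftFunctor DX n).Additive] [Pretriangulated DX] [IsTriangulated DX] [Linear k DX]
  {DU : Type u₃} [Category.{v₃} DU] [Preadditive DU] [HasZeroObject DU] [HasShift DU ℤ]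
  [∀ n : ℤ, (shiftFunctor DU n).Additive] [Pretriangulated DU] [IsTriangulated DU] [Linear k DU]
  (R : Recollement k DZ DX DU) {tZ : TStructure DZ} {tU : TStructure DU}

/-- Full faithfulness of `i_*`, which commutes with the shift, identifies this extension group with
`Hom(P, W[1])`, and that group vanishes for projective `P`. -/
lemma iStar_ext_eq_zero {P W : tZ.heart.FullSubcategory} [Projective P]
    {K : (R.gluedTStructure tZ tU).heart.FullSubcategory}
    (e : (R.heart tZ tU).i.obj W ≅ K)
    (η : ((R.heart tZ tU).i.obj P).obj ⟶ K.obj⟦(1 : ℤ)⟧) : η = 0 := by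
  let e' : R.iStar.obj W.obj ≅ K.obj := (R.gluedTStructure tZ tU).heart.ι.mapIso e
  let e₁ : R.iStar.obj (W.obj⟦(1 : ℤ)⟧) ≅ K.obj⟦(1 : ℤ)⟧ :=
    (R.iStar.commShiftIso (1 : ℤ)).app W.obj ≪≫ (shiftFunctor DX (1 : ℤ)).mapIso e'
  obtain ⟨θ, hθ⟩ := R.iStar.map_surjective (X := P.obj) (η ≫ e₁.inv)
  rw [Heart.ext_eq_zero_of_projective P θ, R.iStar.map_zero] at hθ
  exact (cancel_mono e₁.inv).1 (hθ.symm.trans zero_comp.symm)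

/-- The heart of a glued t-structure has enough projectives if the two given hearts do. -/
theorem enoughProjectives_heart [∀ n : ℤ, (shiftFunctor DX n).Linear k] (hDX : IsHomFinite k DX)
    (hlZ : ∀ W : tZ.heart.FullSubcategory, HasFiniteLength W)
    (hlU : ∀ V : tU.heart.FullSubcategory, HasFiniteLength V)
    (hsU : HasFinitelyManySimples tU.heart.FullSubcategory)
    [EnoughProjectives tZ.heart.FullSubcategory] [EnoughProjectives tU.heart.FullSubcategory] :
    EnoughProjectives (R.gluedTStructure tZ tU).heart.FullSubcategory := by
  let A := R.heart tZ tU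
  have hX := A.hasFiniteLength hlZ hlU
  obtain ⟨n, S, hS⟩ := hsU
  refine A.enoughProjectives_of_exists fun W ↦ ?_
  obtain ⟨P, p, hp⟩ : ∃ (P : tZ.heart.FullSubcategory) (p : P ⟶ W), Projective P ∧ Epi p :=
    ⟨_, Projective.π W, inferInstance, inferInstance⟩
  have := hp.1
  have := hp.2
  obtain ⟨Q, hQ, q, hq⟩ := Heart.exists_projective_of_finite hDX hX (T := A.i.obj P)
    (fun m ↦ A.middle (S m)) (fun m ↦ ⟨A.jl.obj (Projective.over (S m)),
      A.jlAdj.map_projective _ inferInstance,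
      A.jl.map (Projective.π (S m)) ≫ factorThruImage (A.canonical (S m)), epi_comp _ _⟩) (by
      intro K hK
      -- A simple object killed by `j` comes from `Z` and does not extend `i P`; any other is the
      -- intermediate extension of one of the finitely many simples of `U`.
      by_cases hj : IsZero (A.j.obj K)
      · obtain ⟨W', ⟨e⟩⟩ := A.exists_iso K hj
        exact Or.inl (R.iStar_ext_eq_zero e)
      · have := A.simple_j_obj K hj
        obtain ⟨m, ⟨e⟩⟩ := hS _ this
        exact Or.inr ⟨m, A.nonempty_iso_middle K hj e.symm⟩)
  exact ⟨Q, hQ, q ≫ A.i.map p, epi_comp _ _⟩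

end Recollement

end RecollementGluing

theorem proposition4p7
    (k : Type w) [Field k]
    (DZ : Type u₁) [Category.{v₁} DZ] [Preadditive DZ] [HasZeroObject DZ] [HasShift DZ ℤ]
    [∀ n : ℤ, (shiftFunctor DZ n).Additive] [Pretriangulated DZ] [IsTriangulated DZ]
    [Linear k DZ] [∀ n : ℤ, (shiftFunctor DZ n).Linear k]
    (DX : Type u₂) [Category.{v₂} DX] [Preadditive DX] [HasZeroObject DX] [HasShift DX ℤ]
    [∀ n : ℤ, (shiftFunctor DX n).Additive] [Pretriangulated DX] [IsTriangulated DX]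
    [Linear k DX] [∀ n : ℤ, (shiftFunctor DX n).Linear k]
    (DU : Type u₃) [Category.{v₃} DU] [Preadditive DU] [HasZeroObject DU] [HasShift DU ℤ]
    [∀ n : ℤ, (shiftFunctor DU n).Additive] [Pretriangulated DU] [IsTriangulated DU]
    [Linear k DU] [∀ n : ℤ, (shiftFunctor DU n).Linear k]
    (hDZ : IsHomFinite k DZ) (hDX : IsHomFinite k DX) (hDU : IsHomFinite k DU)
    (R : Recollement k DZ DX DU)
    (tZ : TStructure DZ) (tU : TStructure DU)
    (htZ : IsBoundedTStructure tZ) (htU : IsBoundedTStructure tU)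
    (hlZ : IsLengthCategory tZ.heart.FullSubcategory)
    (hlU : IsLengthCategory tU.heart.FullSubcategory)
    (hsZ : HasFinitelyManySimples tZ.heart.FullSubcategory)
    (hsU : HasFinitelyManySimples tU.heart.FullSubcategory) :
    EnoughProjectives (R.gluedTStructure tZ tU).heart.FullSubcategory ↔
      EnoughProjectives tZ.heart.FullSubcategory ∧
        EnoughProjectives tU.heart.FullSubcategory := by
  let A := R.heart tZ tU
  have hX := A.hasFiniteLength hlZ hlU
  constructor
  · intro h
    exact ⟨A.enoughProjectives_closed, A.enoughProjectives_open hX⟩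
  · rintro ⟨hZ, hU⟩
    exact R.enoughProjectives_heart hDX hlZ hlU hsU
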